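/- Conventions: $\mathbb{R}_+=[0,\infty)$, $\mathbb{R}_{++}=(0,\infty)$; "increasing" and "decreasing" are meant strictly. Let $W_1$ be the set of all locally integrable functions $c:\mathbb{R}_+\to\mathbb{R}_+$ and $W_2$ the set of all measurable, locally bounded functions $c:\mathbb{R}_+\to\mathbb{R}_+$. Let $\rho\in\mathbb{R}$, $u:\mathbb{R}_+^2\to\mathbb{R}\cup\{-\infty\}$, written $u(c,k)$, $F:\mathbb{R}_+^2\to\mathbb{R}$, written $F(k,c)$, and a set $W$ of functions satisfy the following. 1. $\rho>0$, and $W=W_1$ or $W=W_2$. 2. $u$ is continuous and concave on $\mathbb{R}_+^2$, nondecreasing in $(c,k)$ on $\mathbb{R}_+^2$, and increasing in $c$ and continuously differentiable on $\mathbb{R}_{++}^2$; and $u(c,0)>-\infty$ for some $c>0$. 3. $F$ is continuous and concave, $F(0,0)=0$, and $F$ is decreasing in $c$. There are $d_1>0$ and an increasing function $\delta_2:\mathbb{R}_+\to\mathbb{R}_+$ with $\delta_2(0)=0$ such that $F(k,c)>-d_1k-\delta_2(c)$ for all $k>0$, $c\ge 0$; if $W=W_1$, then moreover $\delta_2(c)=d_2c$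 for all $c\ge 0$, with some $d_2\ge 0$. For every $c\ge 0$ there is $k>0$ with $F(k,c)>F(0,c)$. 4. For every $k>0$: $c\mapsto\frac{\partial u}{\partial c}(c,k)$ is decreasing on $\mathbb{R}_{++}$, $\lim_{c\downarrow 0}\frac{\partial u}{\partial c}(c,k)=+\infty$, $\lim_{c\to\infty}\frac{\partial u}{\partial c}(c,k)=0$, and $\limsup_{c\downarrow 0}\frac{\partial u}{\partial k}(c,k)<+\infty$. For $\bar k>0$ let $A_{\bar k}$ be the set of all pairs $(k(\cdot),c(\cdot))$ of functions $\mathbb{R}_+\to\mathbb{R}_+$ such that $k$ is absolutely continuous on every compact interval, $c\in W$, the integral $\int_0^\infty e^{-\rho t}u(c(t),k(t))\,dt$ is defined (the values $\pm\infty$ being allowed), $\dot k(t)=F(k(t),c(t))$ for almost every $t\ge 0$, and $k(0)=\bar k$. Define the value function on $\mathbb{R}_{++}$ by $$\bar V(\bar k)=\sup\left\{\int_0^\infty e^{-\rho t}u(c(t),k(t))\,dt \;:\; (k,c)\in A_{\bar k}\right\}.$$ Suppose that $\bar V(k)\in\mathbb{R}$ for every $k>0$, and that $F$ is differentiable in $c$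 at $(k,c)$ (from the right if $c=0$) whenever $k,c\ge 0$ and $F(k,c)=0$. Then $\bar V$ is continuously differentiable on $\mathbb{R}_{++}$, and it is a classical solution to the Hamilton–Jacobi–Bellman equation, that is, $$\sup_{c\ge 0}\{F(k,c)\bar V'(k)+u(c,k)\}-\rho\bar V(k)=0\qquad\text{for every } k>0.$$ -/

import Mathlib

open Set Filter Topology MeasureTheory

noncomputable section

namespace GrowthModel

/-- The set `W₁` of locally integrable functions from `[0, ∞)` to `[0, ∞)`
(a function on `ℝ` of which only the restriction to `[0, ∞)` matters). -/
def W₁ : Set (ℝ → ℝ) :=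
  {c | (∀ t, 0 ≤ t → 0 ≤ c t) ∧ LocallyIntegrableOn c (Ici 0) volume}

/-- The set `W₂` of (Lebesgue) measurable, locally bounded functions from `[0, ∞)` to `[0, ∞)`. -/
def W₂ : Set (ℝ → ℝ) :=
  {c | (∀ t, 0 ≤ t → 0 ≤ c t) ∧ AEMeasurable c (volume.restrict (Ici 0)) ∧
    ∀ T : ℝ, ∃ M : ℝ, ∀ t ∈ Icc 0 T, c t ≤ M}

/-- Standing assumption on the discount rate and on the space of consumption paths. -/
structure Assumption1 (ρ : ℝ) (W : Set (ℝ → ℝ)) : Prop where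
  rho_pos : 0 < ρ
  W_eq : W = W₁ ∨ W = W₂

/-- Assumption on the instantaneous utility function `u (c, k)`, defined for `c, k ≥ 0`,
with values in `ℝ ∪ {-∞}`. -/
structure Assumption2 (u : ℝ → ℝ → EReal) : Prop where
  ne_top : ∀ c k, 0 ≤ c → 0 ≤ k → u c k ≠ ⊤
  continuousOn : ContinuousOn (fun x : ℝ × ℝ => u x.1 x.2) (Ici 0 ×ˢ Ici 0)
  concave : ∀ c₁ k₁ c₂ k₂ a b : ℝ, 0 ≤ c₁ → 0 ≤ k₁ → 0 ≤ c₂ → 0 ≤ k₂ →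
    0 < a → 0 < b → a + b = 1 →
    (a : EReal) * u c₁ k₁ + (b : EReal) * u c₂ k₂ ≤ u (a * c₁ + b * c₂) (a * k₁ + b * k₂)
  nondecreasing : ∀ c₁ k₁ c₂ k₂ : ℝ, 0 ≤ c₁ → 0 ≤ k₁ → c₁ ≤ c₂ → k₁ ≤ k₂ → u c₁ k₁ ≤ u c₂ k₂
  increasing : ∀ k : ℝ, 0 < k → StrictMonoOn (fun c => u c k) (Ioi 0)
  contDiffOn : ContDiffOn ℝ 1 (fun x : ℝ × ℝ => (u x.1 x.2).toReal) (Ioi 0 ×ˢ Ioi 0)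
  exists_ne_bot : ∃ c : ℝ, 0 < c ∧ u c 0 ≠ ⊥

/-- Assumption on the technology function `F (k, c)`, defined for `k, c ≥ 0`. -/
structure Assumption3 (F : ℝ → ℝ → ℝ) (W : Set (ℝ → ℝ)) : Prop where
  continuousOn : ContinuousOn (fun x : ℝ × ℝ => F x.1 x.2) (Ici 0 ×ˢ Ici 0)
  concave : ConcaveOn ℝ (Ici 0 ×ˢ Ici 0) (fun x : ℝ × ℝ => F x.1 x.2)
  zero : F 0 0 = 0
  decreasing : ∀ k : ℝ, 0 ≤ k → StrictAntiOn (fun c => F k c) (Ici 0)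
  lower_bound : ∃ d₁ : ℝ, 0 < d₁ ∧ ∃ δ₂ : ℝ → ℝ, StrictMonoOn δ₂ (Ici 0) ∧ δ₂ 0 = 0 ∧
    (∀ k c : ℝ, 0 < k → 0 ≤ c → -d₁ * k - δ₂ c < F k c) ∧
    (W = W₁ → ∃ d₂ : ℝ, 0 ≤ d₂ ∧ ∀ c : ℝ, 0 ≤ c → δ₂ c = d₂ * c)
  exists_gt : ∀ c : ℝ, 0 ≤ c → ∃ k : ℝ, 0 < k ∧ F 0 c < F k c

/-- The partial derivative `∂u/∂c (c, k)`. -/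
def du_dc (u : ℝ → ℝ → EReal) (c k : ℝ) : ℝ := deriv (fun x => (u x k).toReal) c

/-- The partial derivative `∂u/∂k (c, k)`. -/
def du_dk (u : ℝ → ℝ → EReal) (c k : ℝ) : ℝ := deriv (fun x => (u c x).toReal) k

/-- Assumption on the partial derivatives of the utility function. -/
structure Assumption4 (u : ℝ → ℝ → EReal) : Prop where
  decreasing : ∀ k : ℝ, 0 < k → StrictAntiOn (fun c => du_dc u c k) (Ioi 0)
  tendsto_zero : ∀ k : ℝ, 0 < k → Tendsto (fun c => du_dc u c k) (𝓝[>] 0) atTop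
  tendsto_infty : ∀ k : ℝ, 0 < k → Tendsto (fun c => du_dc u c k) atTop (𝓝 0)
  limsup_lt : ∀ k : ℝ, 0 < k → limsup (fun c => ((du_dk u c k : ℝ) : EReal)) (𝓝[>] 0) < ⊤

/-- The integral over `[0, ∞)` of the positive part of `e^{-ρt} u(c(t), k(t))`. -/
def posIntegral (ρ : ℝ) (u : ℝ → ℝ → EReal) (k c : ℝ → ℝ) : ENNReal :=
  ∫⁻ t in Ici (0 : ℝ), ((Real.exp (-ρ * t) : EReal) * u (c t) (k t)).toENNReal

/-- The integral over `[0, ∞)` of the negative part of `e^{-ρt} u(c(t), k(t))`. -/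
def negIntegral (ρ : ℝ) (u : ℝ → ℝ → EReal) (k c : ℝ → ℝ) : ENNReal :=
  ∫⁻ t in Ici (0 : ℝ), (-((Real.exp (-ρ * t) : EReal) * u (c t) (k t))).toENNReal

/-- `∫₀^∞ e^{-ρt} u(c(t), k(t)) dt` can be defined, the values `±∞` being allowed. -/
def UtilityDefined (ρ : ℝ) (u : ℝ → ℝ → EReal) (k c : ℝ → ℝ) : Prop :=
  posIntegral ρ u k c ≠ ⊤ ∨ negIntegral ρ u k c ≠ ⊤

/-- The extended real number `∫₀^∞ e^{-ρt} u(c(t), k(t)) dt`. -/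
def totalUtility (ρ : ℝ) (u : ℝ → ℝ → EReal) (k c : ℝ → ℝ) : EReal :=
  (posIntegral ρ u k c : EReal) - (negIntegral ρ u k c : EReal)

/-- The pair `(k(t), c(t))` is admissible and starts from `k(0) = kbar`. -/
structure Admissible (ρ : ℝ) (u : ℝ → ℝ → EReal) (F : ℝ → ℝ → ℝ) (W : Set (ℝ → ℝ))
    (kbar : ℝ) (k c : ℝ → ℝ) : Prop where
  mem_W : c ∈ W
  absolutelyContinuous : ∀ a b : ℝ, 0 ≤ a → a ≤ b → AbsolutelyContinuousOnInterval k a b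
  k_nonneg : ∀ t : ℝ, 0 ≤ t → 0 ≤ k t
  c_nonneg : ∀ t : ℝ, 0 ≤ t → 0 ≤ c t
  utilityDefined : UtilityDefined ρ u k c
  ode : ∀ᵐ t ∂(volume.restrict (Ici (0 : ℝ))), HasDerivAt k (F (k t) (c t)) t
  initial : k 0 = kbar

/-- The value function, a supremum in the extended real numbers. -/
def valueFunction (ρ : ℝ) (u : ℝ → ℝ → EReal) (F : ℝ → ℝ → ℝ) (W : Set (ℝ → ℝ))
    (kbar : ℝ) : EReal :=
  sSup {v : EReal | ∃ k c : ℝ → ℝ, Admissible ρ u F W kbar k c ∧ v = totalUtility ρ u k c}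

/-- An extended real function on `(0, ∞)` is finite if all its values there are real. -/
def IsFinite (V : ℝ → EReal) : Prop := ∀ k : ℝ, 0 < k → V k ≠ ⊥ ∧ V k ≠ ⊤

/-- `V` is real-valued and continuously differentiable on `(0, ∞)`. -/
def IsContDiff (V : ℝ → EReal) : Prop :=
  IsFinite V ∧ ContDiffOn ℝ 1 (fun k => (V k).toReal) (Ioi 0)

/-- `V` is a classical solution to the Hamilton-Jacobi-Bellman equation
`sup_{c ≥ 0} {F(k, c) V'(k) + u(c, k)} - ρ V(k) = 0` on `(0, ∞)`. -/
def IsClassicalSolution (ρ : ℝ) (u : ℝ → ℝ → EReal) (F : ℝ → ℝ → ℝ) (V : ℝ → EReal) : Prop :=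
  IsContDiff V ∧ ∀ k : ℝ, 0 < k →
    (⨆ c ∈ Ici (0 : ℝ), (((F k c * deriv (fun x => (V x).toReal) k : ℝ) : EReal) + u c k))
      - (ρ : EReal) * V k = 0

end GrowthModel

end

/-! Joint concavity of `u` and `F` makes the value function V concave: a convex combination of two
plans accumulates capital no faster than the technology allows, and the surplus can be consumed
(`le_valueFunction`). So V has supergradients at each x > 0, and a concave function with a unique
supergradient at every point is C¹. All rests on showing that every supergradient p, not only a
derivative, solves H(x, p) = ρV(x), where H(k, p) is the supremum over c of F(k, c)p + u(c, k).

For H ≤ ρV (`Standing.hamiltonian_le`), start at x − vT with v = F(x, c) and drive capital into x at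
constant speed v. This bounds V(x − vT) from below, the supergradient bounds it from above, and T →
0 gives the inequality.

For H ≥ ρV (`Standing.exists_le_hamiltonian_add`), integrate along a nearly optimal plan the bound
on u + qF given by the concavity of H(·, q), with q < p. Capital may drop arbitrarily fast, so its
displacement has no lower bound proportional to T; the gap p − q turns a drop into a loss that
absorbs the error terms. Then q ↑ p, by continuity of the convex function H(x, ·) on (0, ∞). This
needs p > 0 (`Standing.supergradient_pos`).

If p < q were both supergradients at x, H(x, ·) would be constant on [p, q]. Near-maximizers at the
midpoint are then nearly optimal at both ends, which forces F → 0; a limit c has F(x, c) = 0 and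
u(c, x) = ρV(x) (`Standing.exists_stationary`). Differentiability of F at exactly such points gives
a first-order condition that determines the price when c > 0, while the infinite marginal utility at
zero excludes c = 0 (`Standing.price_unique`). -/

namespace GrowthModel

/-! ### Utility: tangent bounds, marginal utility and the boundary of the quadrant -/

section Utility

variable {u : ℝ → ℝ → EReal}

theorem Assumption2.ne_bot (h2 : Assumption2 u) {c k : ℝ} (hc : 0 < c) (hk : 0 < k) :
    u c k ≠ ⊥ := by
  have h := h2.increasing k hk (show c / 2 ∈ Ioi 0 from half_pos hc) (show c ∈ Ioi 0 from hc)
    (half_lt_self hc)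
  exact (bot_le.trans_lt h).ne'

theorem Assumption2.coe_toReal (h2 : Assumption2 u) {c k : ℝ} (hc : 0 < c) (hk : 0 < k) :
    ((u c k).toReal : EReal) = u c k :=
  EReal.coe_toReal (h2.ne_top c k hc.le hk.le) (h2.ne_bot hc hk)

theorem Assumption2.toReal_le (h2 : Assumption2 u) {c k c' k' : ℝ} (hc : 0 < c) (hk : 0 < k)
    (hc' : c ≤ c') (hk' : k ≤ k') : (u c k).toReal ≤ (u c' k').toReal := by
  have := h2.nondecreasing c k c' k' hc.le hk.le hc' hk'
  rw [← h2.coe_toReal hc hk, ← h2.coe_toReal (hc.trans_le hc') (hk.trans_le hk')] at this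
  exact_mod_cast this

theorem Assumption2.toReal_lt (h2 : Assumption2 u) {c k c' : ℝ} (hc : 0 < c) (hk : 0 < k)
    (hc' : c < c') : (u c k).toReal < (u c' k).toReal := by
  have : u c k < u c' k := h2.increasing k hk (show c ∈ Ioi 0 from hc)
    (show c' ∈ Ioi 0 from hc.trans hc') hc'
  rw [← h2.coe_toReal hc hk, ← h2.coe_toReal (hc.trans hc') hk] at this
  exact_mod_cast this

theorem Assumption2.concaveOn (h2 : Assumption2 u) :
    ConcaveOn ℝ (Ioi 0 ×ˢ Ioi 0) (fun x : ℝ × ℝ => (u x.1 x.2).toReal) := by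
  refine concaveOn_iff_forall_pos.2 ⟨(convex_Ioi 0).prod (convex_Ioi 0), ?_⟩
  rintro ⟨c₁, k₁⟩ ⟨hc₁, hk₁⟩ ⟨c₂, k₂⟩ ⟨hc₂, hk₂⟩ a b ha hb hab
  simp only [mem_Ioi] at hc₁ hk₁ hc₂ hk₂
  have h := h2.concave c₁ k₁ c₂ k₂ a b hc₁.le hk₁.le hc₂.le hk₂.le ha hb hab
  rw [← h2.coe_toReal hc₁ hk₁, ← h2.coe_toReal hc₂ hk₂,
    ← h2.coe_toReal (by positivity : 0 < a * c₁ + b * c₂) (by positivity : 0 < a * k₁ + b * k₂)] at h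
  simpa using (by exact_mod_cast h : a * (u c₁ k₁).toReal + b * (u c₂ k₂).toReal ≤ _)

theorem Assumption2.concaveOn_left (h2 : Assumption2 u) {k : ℝ} (hk : 0 < k) :
    ConcaveOn ℝ (Ioi 0) (fun c => (u c k).toReal) := by
  refine ⟨convex_Ioi 0, fun x hx y hy a b ha hb hab => ?_⟩
  have := h2.concaveOn.2 (show (x, k) ∈ Ioi (0 : ℝ) ×ˢ Ioi (0 : ℝ) from ⟨hx, hk⟩)
    (show (y, k) ∈ Ioi (0 : ℝ) ×ˢ Ioi (0 : ℝ) from ⟨hy, hk⟩) ha hb hab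
  simpa [← add_mul, hab] using this

theorem Assumption2.hasDerivAt (h2 : Assumption2 u) {c k : ℝ} (hc : 0 < c) (hk : 0 < k) :
    HasDerivAt (fun x => (u x k).toReal) (du_dc u c k) c := by
  have h : DifferentiableAt ℝ (fun x : ℝ × ℝ => (u x.1 x.2).toReal) (c, k) :=
    (h2.contDiffOn.contDiffAt ((isOpen_Ioi.prod isOpen_Ioi).mem_nhds
      (show (c, k) ∈ Ioi (0 : ℝ) ×ˢ Ioi (0 : ℝ) from ⟨hc, hk⟩))).differentiableAt (by simp)
  have h' : DifferentiableAt ℝ (fun x : ℝ => (x, k)) c := by fun_prop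
  exact (DifferentiableAt.comp (g := fun x : ℝ × ℝ => (u x.1 x.2).toReal) c h h').hasDerivAt

/-- The graph of a concave utility lies below its tangent lines. -/
theorem Assumption2.le_tangent (h2 : Assumption2 u) {c c₁ k : ℝ} (hc : 0 < c) (hc₁ : 0 < c₁)
    (hk : 0 < k) : (u c k).toReal ≤ (u c₁ k).toReal + du_dc u c₁ k * (c - c₁) := by
  have hd := h2.hasDerivAt hc₁ hk
  rcases lt_trichotomy c c₁ with h | h | h
  · have := (h2.concaveOn_left hk).le_slope_of_hasDerivAt hc hc₁ h hd
    rw [slope_def_field, le_div_iff₀ (by linarith)] at this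
    linarith
  · simp [h]
  · have := (h2.concaveOn_left hk).slope_le_of_hasDerivAt hc₁ hc h hd
    rw [slope_def_field, div_le_iff₀ (by linarith)] at this
    linarith

theorem du_dc_pos (h2 : Assumption2 u) {c k : ℝ} (hc : 0 < c) (hk : 0 < k) : 0 < du_dc u c k := by
  have h := h2.le_tangent (by linarith : 0 < c + 1) hc hk
  have h' := h2.toReal_lt hc hk (lt_add_one c)
  simp only [add_sub_cancel_left, mul_one] at h
  linarith

/-- The utility as a continuous function on the whole plane. -/
theorem Assumption2.continuous_extend (h2 : Assumption2 u) :
    Continuous (fun x : ℝ × ℝ => u (max x.1 0) (max x.2 0)) := by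
  have hf : Continuous (fun x : ℝ × ℝ => (max x.1 0, max x.2 0)) := by fun_prop
  exact h2.continuousOn.comp_continuous hf fun x => ⟨mem_Ici.2 (le_max_right _ _), mem_Ici.2 (le_max_right _ _)⟩

/-- Continuity on the closed quadrant lets affine bounds pass to its boundary. -/
theorem Assumption2.le_of_le_interior (h2 : Assumption2 u) {φ : ℝ × ℝ → ℝ}
    (hφ : ContinuousOn φ (Ici 0 ×ˢ Ici 0))
    (h : ∀ c k, 0 < c → 0 < k → (u c k).toReal ≤ φ (c, k)) {c k : ℝ} (hc : 0 ≤ c) (hk : 0 ≤ k) :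
    u c k ≤ φ (c, k) := by
  have hmem : (c, k) ∈ Ici (0 : ℝ) ×ˢ Ici (0 : ℝ) := ⟨hc, hk⟩
  have hs : Tendsto (fun e : ℝ => (c + e, k + e)) (𝓝[>] 0) (𝓝[Ici 0 ×ˢ Ici 0] (c, k)) := by
    refine tendsto_nhdsWithin_iff.2 ⟨?_, ?_⟩
    · have : Continuous (fun e : ℝ => (c + e, k + e)) := by fun_prop
      simpa using (this.tendsto 0).mono_left nhdsWithin_le_nhds
    · filter_upwards [self_mem_nhdsWithin] with e he
      have : (0 : ℝ) < e := he
      exact ⟨by simp; linarith, by simp; linarith⟩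
  have h₁ := (h2.continuousOn (c, k) hmem).tendsto.comp hs
  have h₂ := (continuous_coe_real_ereal.tendsto _).comp ((hφ (c, k) hmem).tendsto.comp hs)
  refine le_of_tendsto_of_tendsto h₁ h₂ ?_
  filter_upwards [self_mem_nhdsWithin] with e he
  have he : (0 : ℝ) < e := he
  simp only [Function.comp]
  rw [← h2.coe_toReal (by linarith : 0 < c + e) (by linarith : 0 < k + e)]
  exact_mod_cast h _ _ (by linarith) (by linarith)

end Utility

/-! ### Technology: linear bounds and inversion in consumption -/

section Technology

variable {F : ℝ → ℝ → ℝ} {W : Set (ℝ → ℝ)}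

theorem Assumption3.continuous_extend (h3 : Assumption3 F W) :
    Continuous (fun x : ℝ × ℝ => F (max x.1 0) (max x.2 0)) := by
  have hf : Continuous (fun x : ℝ × ℝ => (max x.1 0, max x.2 0)) := by fun_prop
  exact h3.continuousOn.comp_continuous hf fun x => ⟨mem_Ici.2 (le_max_right _ _), mem_Ici.2 (le_max_right _ _)⟩

theorem Assumption3.continuousOn_right (h3 : Assumption3 F W) {k : ℝ} (hk : 0 ≤ k) :
    ContinuousOn (F k) (Ici 0) :=
  h3.continuousOn.comp (f := fun c : ℝ => (k, c)) (by fun_prop) fun _ hc => ⟨hk, hc⟩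

theorem Assumption3.continuousOn_left (h3 : Assumption3 F W) {c : ℝ} (hc : 0 ≤ c) :
    ContinuousOn (fun k => F k c) (Ici 0) :=
  h3.continuousOn.comp (f := fun k : ℝ => (k, c)) (by fun_prop) fun _ hk => ⟨hk, hc⟩

theorem Assumption3.antitone (h3 : Assumption3 F W) {k c c' : ℝ} (hk : 0 ≤ k) (hc : 0 ≤ c)
    (h : c ≤ c') : F k c' ≤ F k c :=
  (h3.decreasing k hk).antitoneOn hc (hc.trans h) h

theorem Assumption3.concave_left (h3 : Assumption3 F W) {c : ℝ} (hc : 0 ≤ c) :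
    ConcaveOn ℝ (Ici 0) (fun k => F k c) := by
  refine ⟨convex_Ici 0, fun x hx y hy a b ha hb hab => ?_⟩
  have := h3.concave.2 (show (x, c) ∈ Ici (0 : ℝ) ×ˢ Ici (0 : ℝ) from ⟨hx, hc⟩)
    (show (y, c) ∈ Ici (0 : ℝ) ×ˢ Ici (0 : ℝ) from ⟨hy, hc⟩) ha hb hab
  simpa [← add_mul, hab] using this

theorem Assumption3.concave_right (h3 : Assumption3 F W) {k : ℝ} (hk : 0 ≤ k) :
    ConcaveOn ℝ (Ici 0) (F k) := by
  refine ⟨convex_Ici 0, fun x hx y hy a b ha hb hab => ?_⟩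
  have := h3.concave.2 (show (k, x) ∈ Ici (0 : ℝ) ×ˢ Ici (0 : ℝ) from ⟨hk, hx⟩)
    (show (k, y) ∈ Ici (0 : ℝ) ×ˢ Ici (0 : ℝ) from ⟨hk, hy⟩) ha hb hab
  simpa [← add_mul, hab] using this

/-- For bounded capital, production net of consumption decreases at least linearly in consumption. -/
theorem Assumption3.exists_linear_bound (h3 : Assumption3 F W) (K : ℝ) :
    ∃ A m : ℝ, 0 < m ∧ ∀ k c, 0 ≤ k → k ≤ K → 0 ≤ c → F k c ≤ A - m * c := by
  rcases lt_or_ge K 0 with hK | hK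
  · exact ⟨0, 1, one_pos, fun k c h h' => by linarith⟩
  have hsub : Icc 0 K ⊆ Ici (0 : ℝ) := fun x hx => hx.1
  have h0 := (h3.continuousOn_left le_rfl).mono hsub
  have h1 := (h3.continuousOn_left zero_le_one).mono hsub
  obtain ⟨x, hx, hmin⟩ := isCompact_Icc.exists_isMinOn ⟨0, left_mem_Icc.2 hK⟩ (h0.sub h1)
  obtain ⟨y, hy, hmax⟩ := isCompact_Icc.exists_isMaxOn ⟨0, left_mem_Icc.2 hK⟩ h0
  have hm : 0 < F x 0 - F x 1 :=
    sub_pos.2 (h3.decreasing x hx.1 (mem_Ici.2 le_rfl) (mem_Ici.2 zero_le_one) one_pos)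
  -- The slope is the least drop of `F k` over [0, 1] for k in the compact interval. Concavity in c
  -- keeps at least this slope beyond 1; adding it to the constant covers c ≤ 1.
  refine ⟨F y 0 + (F x 0 - F x 1), F x 0 - F x 1, hm, fun k c hk hkK hc => ?_⟩
  have e1 : F x 0 - F x 1 ≤ F k 0 - F k 1 := hmin ⟨hk, hkK⟩
  have e2 : F k 0 ≤ F y 0 := hmax ⟨hk, hkK⟩
  rcases le_total c 1 with h | h
  · have := h3.antitone hk le_rfl hc
    nlinarith
  · have hcpos : 0 < c := by linarith
    have := (h3.concave_right hk).2 (mem_Ici.2 le_rfl : (0 : ℝ) ∈ Ici 0) (mem_Ici.2 hc)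
      (show 0 ≤ 1 - 1 / c by rw [sub_nonneg, div_le_one hcpos]; exact h)
      (show 0 ≤ 1 / c by positivity) (by ring)
    simp only [smul_eq_mul, mul_zero, zero_add, one_div_mul_cancel hcpos.ne'] at this
    have h5 : (1 - 1 / c) * F k 0 + 1 / c * F k c = F k 0 - (F k 0 - F k c) / c := by
      field_simp
      ring
    rw [h5] at this
    have h6 : F k 0 - F k 1 ≤ (F k 0 - F k c) / c := by linarith
    rw [le_div_iff₀ hcpos] at h6
    nlinarith

/-- Production grows at most linearly in capital. -/
theorem Assumption3.exists_growth_bound (h3 : Assumption3 F W) :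
    ∃ A : ℝ, 0 < A ∧ ∀ k c, 0 ≤ k → 0 ≤ c → F k c ≤ A * (1 + k) := by
  have h0 := (h3.continuousOn_left le_rfl).mono (fun x (hx : x ∈ Icc (0 : ℝ) 1) => hx.1)
  obtain ⟨y, hy, hmax⟩ := isCompact_Icc.exists_isMaxOn ⟨0, left_mem_Icc.2 zero_le_one⟩ h0
  have hb : ∀ k, 0 ≤ k → k ≤ 1 → F k 0 ≤ |F y 0| + 1 := fun k hk hk1 => by
    have : F k 0 ≤ F y 0 := hmax ⟨hk, hk1⟩
    linarith [le_abs_self (F y 0)]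
  have hA : 0 < |F y 0| + 1 := by positivity
  refine ⟨|F y 0| + 1, hA, fun k c hk hc => (h3.antitone hk le_rfl hc).trans ?_⟩
  rcases le_total k 1 with h | h
  · nlinarith [hb k hk h]
  · have hkpos : 0 < k := by linarith
    have := (h3.concave_left le_rfl).2 (mem_Ici.2 le_rfl : (0 : ℝ) ∈ Ici 0) (mem_Ici.2 hk)
      (show 0 ≤ 1 - 1 / k by rw [sub_nonneg, div_le_one hkpos]; exact h)
      (show 0 ≤ 1 / k by positivity) (by ring)
    simp only [smul_eq_mul, mul_zero, zero_add, one_div_mul_cancel hkpos.ne', h3.zero] at this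
    rw [one_div_mul_eq_div, div_le_iff₀ hkpos] at this
    nlinarith [hb 1 zero_le_one le_rfl]

/-- Lower speeds of capital are attained by raising consumption. -/
theorem Assumption3.exists_consumption (h3 : Assumption3 F W) {k c v : ℝ} (hk : 0 ≤ k)
    (hc : 0 ≤ c) (hv : v ≤ F k c) : ∃ c', c ≤ c' ∧ F k c' = v := by
  obtain ⟨A, m, hm, hb⟩ := h3.exists_linear_bound k
  set C := max c ((A - v) / m)
  have hcC : c ≤ C := le_max_left _ _
  have hC : F k C ≤ v := by
    have h1 := hb k C hk le_rfl (hc.trans hcC)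
    have h2 : (A - v) / m ≤ C := le_max_right _ _
    rw [div_le_iff₀ hm] at h2
    linarith
  obtain ⟨c', hc', h⟩ := intermediate_value_Icc' hcC
    ((h3.continuousOn_right hk).mono fun x hx => hc.trans hx.1) ⟨hC, hv⟩
  exact ⟨c', hc'.1, h⟩

/-- The consumption with which capital `k` grows at speed `v`. -/
noncomputable def consumption (F : ℝ → ℝ → ℝ) (x : ℝ × ℝ) : ℝ :=
  open Classical in if h : ∃ c, 0 ≤ c ∧ F (max x.1 0) c = x.2 then h.choose else 0

theorem consumption_nonneg (F : ℝ → ℝ → ℝ) (x : ℝ × ℝ) : 0 ≤ consumption F x := by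
  unfold consumption
  split_ifs with h
  · exact h.choose_spec.1
  · exact le_rfl

theorem Assumption3.consumption_eq_max (h3 : Assumption3 F W) {k v : ℝ}
    (hv : v ≤ F (max k 0) 0) : F (max k 0) (consumption F (k, v)) = v := by
  have h : ∃ c, 0 ≤ c ∧ F (max k 0) c = v :=
    h3.exists_consumption (le_max_right _ _) le_rfl hv
  unfold consumption
  rw [dif_pos h]
  exact h.choose_spec.2

theorem Assumption3.consumption_eq (h3 : Assumption3 F W) {k v : ℝ} (hk : 0 ≤ k)
    (hv : v ≤ F k 0) : F k (consumption F (k, v)) = v := by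
  have := h3.consumption_eq_max (k := k) (v := v)
  rw [max_eq_left hk] at this
  exact this hv

/-- Since `F k` is strictly decreasing, for a ≥ 0 the sublevel set at a is the union of F(k, a) ≤ v
with the region v > F(k, 0), where the default value 0 applies. Truncating k at 0 makes both
conditions meaningful on the whole plane. -/
theorem Assumption3.measurable_consumption (h3 : Assumption3 F W) :
    Measurable (consumption F) := by
  have hF : ∀ a : ℝ, 0 ≤ a → Measurable (fun x : ℝ × ℝ => F (max x.1 0) a) := fun a ha => by
    have : Continuous (fun x : ℝ × ℝ => (x.1, a)) := by fun_prop
    simpa [Function.comp_def, max_eq_left ha] using (h3.continuous_extend.comp this).measurable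
  refine measurable_of_Iic fun a => ?_
  rcases lt_or_ge a 0 with ha | ha
  · convert! MeasurableSet.empty
    ext x
    simpa using ha.trans_le (consumption_nonneg F x)
  · convert! (measurableSet_lt (hF 0 le_rfl) measurable_snd).union
      (measurableSet_le (hF a ha) measurable_snd)
    ext ⟨k, v⟩
    simp only [mem_preimage, mem_Iic, mem_union, mem_ofPred_eq]
    have hk : 0 ≤ max k 0 := le_max_right _ _
    rcases lt_or_ge (F (max k 0) 0) v with hv | hv
    · simp only [hv, true_or, iff_true]
      unfold consumption
      rw [dif_neg]
      · exact ha
      · rintro ⟨c, hc, h⟩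
        have := h3.antitone hk le_rfl hc
        simp only at h
        linarith
    · have hn := consumption_nonneg F (k, v)
      rw [or_iff_right (not_lt.2 hv), ← (h3.decreasing _ hk).le_iff_ge ha hn,
        h3.consumption_eq_max hv]

end Technology

/-! ### Extended-valued total utility as a real integral -/

section TotalUtility

variable {ρ : ℝ} {u : ℝ → ℝ → EReal} {k c : ℝ → ℝ}

/-- The discounted utility at time `t`, as a real number. -/
noncomputable def discounted (ρ : ℝ) (u : ℝ → ℝ → EReal) (k c : ℝ → ℝ) (t : ℝ) : ℝ :=
  Real.exp (-ρ * t) * (u (c t) (k t)).toReal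

theorem aemeasurable_utility (h2 : Assumption2 u)
    (hk : AEMeasurable k (volume.restrict (Ici 0))) (hc : AEMeasurable c (volume.restrict (Ici 0)))
    (hk0 : ∀ t, 0 ≤ t → 0 ≤ k t) (hc0 : ∀ t, 0 ≤ t → 0 ≤ c t) :
    AEMeasurable (fun t => u (c t) (k t)) (volume.restrict (Ici 0)) := by
  refine (h2.continuous_extend.measurable.comp_aemeasurable (hc.prodMk hk)).congr ?_
  filter_upwards [ae_restrict_mem measurableSet_Ici] with t ht
  simp [max_eq_left (hk0 t ht), max_eq_left (hc0 t ht)]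

theorem aemeasurable_discounted (hu : AEMeasurable (fun t => u (c t) (k t))
    (volume.restrict (Ici 0))) :
    AEMeasurable (discounted ρ u k c) (volume.restrict (Ici 0)) :=
  (Measurable.aemeasurable (by fun_prop)).mul hu.ereal_toReal

theorem exp_mul_utility (h2 : Assumption2 u) {t : ℝ} (hk0 : 0 ≤ k t) (hc0 : 0 ≤ c t)
    (hb : u (c t) (k t) ≠ ⊥) :
    (Real.exp (-ρ * t) : EReal) * u (c t) (k t) = (discounted ρ u k c t : ℝ) := by
  rw [discounted, EReal.coe_mul, EReal.coe_toReal (h2.ne_top _ _ hc0 hk0) hb]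

theorem posIntegral_eq (h2 : Assumption2 u)
    (hk0 : ∀ t, 0 ≤ t → 0 ≤ k t) (hc0 : ∀ t, 0 ≤ t → 0 ≤ c t)
    (hb : ∀ᵐ t ∂volume.restrict (Ici (0 : ℝ)), u (c t) (k t) ≠ ⊥) :
    posIntegral ρ u k c = ∫⁻ t in Ici (0 : ℝ), ENNReal.ofReal (discounted ρ u k c t) := by
  refine lintegral_congr_ae ?_
  filter_upwards [ae_restrict_mem measurableSet_Ici, hb] with t ht hbt
  rw [exp_mul_utility h2 (hk0 t ht) (hc0 t ht) hbt]
  simp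

theorem negIntegral_eq (h2 : Assumption2 u)
    (hk0 : ∀ t, 0 ≤ t → 0 ≤ k t) (hc0 : ∀ t, 0 ≤ t → 0 ≤ c t)
    (hb : ∀ᵐ t ∂volume.restrict (Ici (0 : ℝ)), u (c t) (k t) ≠ ⊥) :
    negIntegral ρ u k c = ∫⁻ t in Ici (0 : ℝ), ENNReal.ofReal (-discounted ρ u k c t) := by
  refine lintegral_congr_ae ?_
  filter_upwards [ae_restrict_mem measurableSet_Ici, hb] with t ht hbt
  rw [exp_mul_utility h2 (hk0 t ht) (hc0 t ht) hbt, ← EReal.coe_neg]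
  simp

theorem ae_ne_bot_of_negIntegral (hu : AEMeasurable (fun t => u (c t) (k t))
    (volume.restrict (Ici 0))) (h : negIntegral ρ u k c ≠ ⊤) :
    ∀ᵐ t ∂volume.restrict (Ici (0 : ℝ)), u (c t) (k t) ≠ ⊥ := by
  have hm : AEMeasurable (fun t => (-((Real.exp (-ρ * t) : EReal) * u (c t) (k t))).toENNReal)
      (volume.restrict (Ici 0)) := by
    have he : AEMeasurable (fun t : ℝ => (Real.exp (-ρ * t) : EReal)) (volume.restrict (Ici 0)) :=
      (Measurable.aemeasurable (f := fun t : ℝ => Real.exp (-ρ * t)) (by fun_prop)).coe_real_ereal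
    exact (measurable_neg.comp_aemeasurable (he.mul hu)).ereal_toENNReal
  filter_upwards [ae_lt_top' hm h] with t ht hbot
  rw [hbot, EReal.coe_mul_bot_of_pos (Real.exp_pos _)] at ht
  simp at ht

theorem integrable_discounted (hu : AEMeasurable (discounted ρ u k c) (volume.restrict (Ici 0)))
    (hp : ∫⁻ t in Ici (0 : ℝ), ENNReal.ofReal (discounted ρ u k c t) ≠ ⊤)
    (hn : ∫⁻ t in Ici (0 : ℝ), ENNReal.ofReal (-discounted ρ u k c t) ≠ ⊤) :
    IntegrableOn (discounted ρ u k c) (Ici 0) := by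
  refine ⟨hu.aestronglyMeasurable, ?_⟩
  rw [hasFiniteIntegral_iff_enorm]
  refine lt_of_le_of_lt (lintegral_mono (g := fun t => ENNReal.ofReal (discounted ρ u k c t) +
    ENNReal.ofReal (-discounted ρ u k c t)) fun t => ?_) ?_
  · rw [Real.enorm_eq_ofReal_abs]
    rcases le_total 0 (discounted ρ u k c t) with h | h
    · rw [abs_of_nonneg h]; exact le_self_add
    · rw [abs_of_nonpos h]; exact le_add_self
  · rw [lintegral_add_left' hu.ennreal_ofReal]
    exact ENNReal.add_lt_top.2 ⟨hp.lt_top, hn.lt_top⟩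

theorem totalUtility_eq (h2 : Assumption2 u)
    (hk0 : ∀ t, 0 ≤ t → 0 ≤ k t) (hc0 : ∀ t, 0 ≤ t → 0 ≤ c t)
    (hb : ∀ᵐ t ∂volume.restrict (Ici (0 : ℝ)), u (c t) (k t) ≠ ⊥)
    (hi : IntegrableOn (discounted ρ u k c) (Ici 0)) :
    totalUtility ρ u k c = ((∫ t in Ici (0 : ℝ), discounted ρ u k c t : ℝ) : EReal) := by
  have hp : ∫⁻ t in Ici (0 : ℝ), ENNReal.ofReal (discounted ρ u k c t) ≠ ⊤ :=
    hi.lintegral_lt_top.ne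
  have hn : ∫⁻ t in Ici (0 : ℝ), ENNReal.ofReal (-discounted ρ u k c t) ≠ ⊤ :=
    hi.neg.lintegral_lt_top.ne
  rw [totalUtility, posIntegral_eq h2 hk0 hc0 hb, negIntegral_eq h2 hk0 hc0 hb,
    integral_eq_lintegral_pos_part_sub_lintegral_neg_part hi, EReal.coe_sub,
    EReal.coe_ennreal_toReal hp, EReal.coe_ennreal_toReal hn]

end TotalUtility

/-! ### Free disposal: from a path of capital to an admissible pair -/

section Realization

variable {ρ : ℝ} {u : ℝ → ℝ → EReal} {F : ℝ → ℝ → ℝ} {W : Set (ℝ → ℝ)}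

theorem locallyIntegrableOn_Ici {v : ℝ → ℝ} (hv : ∀ T, 0 ≤ T → IntervalIntegrable v volume 0 T) :
    LocallyIntegrableOn v (Ici 0) := by
  rw [locallyIntegrableOn_iff isClosed_Ici.isLocallyClosed]
  intro s hs hsc
  obtain ⟨T, hT⟩ := hsc.bddAbove
  have h : s ⊆ Icc 0 (max T 0) := fun x hx => ⟨hs hx, (hT hx).trans (le_max_left _ _)⟩
  exact ((intervalIntegrable_iff_integrableOn_Icc_of_le (le_max_right _ _)).1
    (hv _ (le_max_right T 0))).mono_set h

theorem continuousOn_of_eq_integral {k v : ℝ → ℝ} {x : ℝ}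
    (hv : ∀ T, 0 ≤ T → IntervalIntegrable v volume 0 T)
    (hk : ∀ t, 0 ≤ t → k t = x + ∫ s in (0 : ℝ)..t, v s) : ContinuousOn k (Ici 0) := by
  intro t ht
  have h : ContinuousOn k (Icc 0 (t + 1)) := by
    have ht1 : (0 : ℝ) ≤ t + 1 := by linarith [mem_Ici.1 ht]
    have := intervalIntegral.continuousOn_primitive_interval'
      (hv (t + 1) ht1) (left_mem_uIcc)
    rw [uIcc_of_le ht1] at this
    exact (continuousOn_const.add this).congr fun s hs => hk s hs.1
  refine (h t ⟨ht, by linarith⟩).mono_of_mem_nhdsWithin ?_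
  exact mem_nhdsWithin.2 ⟨Iio (t + 1), isOpen_Iio, by simp, fun s hs => ⟨hs.2, hs.1.le⟩⟩

theorem exists_forall_le {k : ℝ → ℝ} (hk : ContinuousOn k (Ici 0)) (T : ℝ) :
    ∃ K, ∀ t ∈ Icc 0 T, k t ≤ K := by
  obtain ⟨K, hK⟩ := (isCompact_Icc.image_of_continuousOn
    (hk.mono fun t (ht : t ∈ Icc 0 T) => ht.1)).bddAbove
  exact ⟨K, fun t ht => hK (mem_image_of_mem _ ht)⟩

/-- The consumption which realizes a given speed of capital belongs to `W`. -/
theorem consumption_mem (h1 : Assumption1 ρ W) (h3 : Assumption3 F W) {k v : ℝ → ℝ}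
    (hk0 : ∀ t, 0 ≤ t → 0 ≤ k t) (hk : ContinuousOn k (Ici 0))
    (hv : ∀ T, 0 ≤ T → IntervalIntegrable v volume 0 T)
    (hW : W = W₂ → ∀ T, ∃ B, ∀ t ∈ Icc 0 T, B ≤ v t) (hvF : ∀ t, 0 ≤ t → v t ≤ F (k t) 0) :
    (fun t => consumption F (k t, v t)) ∈ W := by
  have hloc := locallyIntegrableOn_Ici hv
  have hm : AEMeasurable (fun t => consumption F (k t, v t)) (volume.restrict (Ici 0)) :=
    h3.measurable_consumption.comp_aemeasurable
      ((hk.aemeasurable measurableSet_Ici).prodMk hloc.aestronglyMeasurable.aemeasurable)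
  -- Consumption is dominated by an affine function of the speed of capital, so it inherits
  -- integrability from `v`, and boundedness from a lower bound on `v`.
  have hbound : ∀ T, ∃ A m : ℝ, 0 < m ∧ ∀ t ∈ Icc 0 T, consumption F (k t, v t) ≤ (A - v t) / m := by
    intro T
    obtain ⟨K, hK⟩ := exists_forall_le hk T
    obtain ⟨A, m, hm, hb⟩ := h3.exists_linear_bound K
    refine ⟨A, m, hm, fun t ht => ?_⟩
    have := hb (k t) (consumption F (k t, v t)) (hk0 t ht.1) (hK t ht) (consumption_nonneg F _)
    rw [h3.consumption_eq (hk0 t ht.1) (hvF t ht.1)] at this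
    rw [le_div_iff₀ hm]
    linarith
  rcases h1.W_eq with h | h
  · rw [h]
    refine ⟨fun t _ => consumption_nonneg F _, ?_⟩
    refine locallyIntegrableOn_Ici fun T hT => ?_
    obtain ⟨A, m, hm', hb⟩ := hbound T
    have hg : IntervalIntegrable (fun t => (A - v t) / m) volume 0 T :=
      ((intervalIntegrable_const).sub (hv T hT)).div_const m
    rw [intervalIntegrable_iff_integrableOn_Icc_of_le hT] at hg ⊢
    refine Integrable.mono' hg (hm.aestronglyMeasurable.mono_set fun t ht => ht.1) ?_
    filter_upwards [ae_restrict_mem measurableSet_Icc] with t ht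
    rw [Real.norm_of_nonneg (consumption_nonneg F _)]
    exact hb t ht
  · have hW' := hW h
    rw [h]
    refine ⟨fun t _ => consumption_nonneg F _, hm, fun T => ?_⟩
    obtain ⟨A, m, hm', hb⟩ := hbound T
    obtain ⟨B, hB⟩ := hW' T
    refine ⟨(A - B) / m, fun t ht => (hb t ht).trans ?_⟩
    have := hB t ht
    gcongr

/-- A lower bound for the value function from a path on which capital accumulates no faster than
the technology allows: the surplus can be consumed. -/
theorem le_valueFunction (h1 : Assumption1 ρ W) (h2 : Assumption2 u) (h3 : Assumption3 F W)
    {k v c l : ℝ → ℝ} {x : ℝ} (hk0 : ∀ t, 0 ≤ t → 0 ≤ k t)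
    (hv : ∀ T, 0 ≤ T → IntervalIntegrable v volume 0 T)
    (hk : ∀ t, 0 ≤ t → k t = x + ∫ s in (0 : ℝ)..t, v s)
    (hW : W = W₂ → ∀ T, ∃ B, ∀ t ∈ Icc 0 T, B ≤ v t)
    (hc0 : ∀ t, 0 ≤ t → 0 ≤ c t) (hvF : ∀ t, 0 ≤ t → v t ≤ F (k t) (c t))
    (hl : ∀ᵐ t ∂volume.restrict (Ici (0 : ℝ)), (l t : EReal) ≤ u (c t) (k t))
    (hi : IntegrableOn (fun t => Real.exp (-ρ * t) * l t) (Ici 0)) :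
    ((∫ t in Ici (0 : ℝ), Real.exp (-ρ * t) * l t : ℝ) : EReal) ≤ valueFunction ρ u F W x := by
  have hkc := continuousOn_of_eq_integral hv hk
  have hvF0 : ∀ t, 0 ≤ t → v t ≤ F (k t) 0 := fun t ht =>
    (hvF t ht).trans (h3.antitone (hk0 t ht) le_rfl (hc0 t ht))
  set g : ℝ → ℝ := fun t => consumption F (k t, v t) with hg
  have hgF : ∀ t, 0 ≤ t → F (k t) (g t) = v t := fun t ht =>
    h3.consumption_eq (hk0 t ht) (hvF0 t ht)
  have hg0 : ∀ t, 0 ≤ g t := fun t => consumption_nonneg F _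
  have hcg : ∀ t, 0 ≤ t → c t ≤ g t := fun t ht => by
    rw [← (h3.decreasing (k t) (hk0 t ht)).le_iff_ge (hg0 t) (hc0 t ht), hgF t ht]
    exact hvF t ht
  have hgW : g ∈ W := consumption_mem h1 h3 hk0 hkc hv hW hvF0
  -- The primitive agrees with `k` for t ≥ 0, and Lebesgue differentiation applies to it directly.
  set κ : ℝ → ℝ := fun t => x + ∫ s in (0 : ℝ)..t, v s with hκ
  have hκk : ∀ t, 0 ≤ t → κ t = k t := fun t ht => (hk t ht).symm
  have hκ0 : ∀ t, 0 ≤ t → 0 ≤ κ t := fun t ht => by rw [hκk t ht]; exact hk0 t ht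
  have hlg : ∀ᵐ t ∂volume.restrict (Ici (0 : ℝ)), (l t : EReal) ≤ u (g t) (κ t) := by
    filter_upwards [hl, ae_restrict_mem measurableSet_Ici] with t ht ht0
    rw [hκk t ht0]
    exact ht.trans (h2.nondecreasing _ _ _ _ (hc0 t ht0) (hk0 t ht0) (hcg t ht0) le_rfl)
  have hb : ∀ᵐ t ∂volume.restrict (Ici (0 : ℝ)), u (g t) (κ t) ≠ ⊥ := by
    filter_upwards [hlg] with t ht hbot
    rw [hbot] at ht
    simp at ht
  have hgm : AEMeasurable g (volume.restrict (Ici 0)) :=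
    h3.measurable_consumption.comp_aemeasurable ((hkc.aemeasurable measurableSet_Ici).prodMk
      (locallyIntegrableOn_Ici hv).aestronglyMeasurable.aemeasurable)
  have hκm : AEMeasurable κ (volume.restrict (Ici 0)) :=
    (hkc.congr fun t ht => hκk t ht).aemeasurable measurableSet_Ici
  have hum := aemeasurable_utility h2 hκm hgm hκ0 (fun t _ => hg0 t)
  have hdm := aemeasurable_discounted (ρ := ρ) hum
  have hle : ∀ᵐ t ∂volume.restrict (Ici (0 : ℝ)),
      Real.exp (-ρ * t) * l t ≤ discounted ρ u κ g t := by
    filter_upwards [hlg, hb, ae_restrict_mem measurableSet_Ici] with t ht hbt ht0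
    rw [← EReal.coe_toReal (h2.ne_top _ _ (hg0 t) (hκ0 t ht0)) hbt] at ht
    exact mul_le_mul_of_nonneg_left (by exact_mod_cast ht) (Real.exp_pos _).le
  have hn : ∫⁻ t in Ici (0 : ℝ), ENNReal.ofReal (-discounted ρ u κ g t) ≠ ⊤ := by
    refine ne_top_of_le_ne_top hi.neg.lintegral_lt_top.ne (lintegral_mono_ae ?_)
    filter_upwards [hle] with t ht
    exact ENNReal.ofReal_le_ofReal (by simpa using ht)
  have hadm : Admissible ρ u F W x κ g := by
    refine ⟨hgW, fun a b ha hab => ?_, hκ0, fun t _ => hg0 t, Or.inr ?_, ?_, by simp [hκ]⟩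
    · have h := (hv b (ha.trans hab)).absolutelyContinuousOnInterval_intervalIntegral
        (c := 0) left_mem_uIcc
      have hx : AbsolutelyContinuousOnInterval (fun _ : ℝ => x) 0 b :=
        ((LipschitzWith.const x).lipschitzOnWith).absolutelyContinuousOnInterval
      refine (hx.add h).mono ?_
      rw [uIcc_of_le hab, uIcc_of_le (ha.trans hab)]
      exact Icc_subset_Icc_left ha
    · rwa [negIntegral_eq h2 hκ0 (fun t _ => hg0 t) hb]
    · have h : ∀ n : ℕ, ∀ᵐ t : ℝ, t ∈ uIcc (0 : ℝ) n → ∀ a ∈ uIcc (0 : ℝ) n,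
          HasDerivAt (fun y => ∫ s in a..y, v s) (v t) t := fun n =>
        (hv n n.cast_nonneg).ae_hasDerivAt_integral
      rw [ae_restrict_iff' measurableSet_Ici]
      filter_upwards [ae_all_iff.2 h] with t ht ht0
      obtain ⟨n, hn⟩ := exists_nat_ge t
      have := ht n (by rw [uIcc_of_le n.cast_nonneg]; exact ⟨ht0, hn⟩) 0 left_mem_uIcc
      rw [hκk t ht0, hgF t ht0]
      exact this.const_add x
  refine le_trans ?_ (le_sSup ⟨κ, g, hadm, rfl⟩)
  -- The negative part is finite, so an infinite positive part makes the total utility `⊤`.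
  by_cases hp : ∫⁻ t in Ici (0 : ℝ), ENNReal.ofReal (discounted ρ u κ g t) = ⊤
  · rw [totalUtility, posIntegral_eq h2 hκ0 (fun t _ => hg0 t) hb,
      negIntegral_eq h2 hκ0 (fun t _ => hg0 t) hb, hp]
    rw [EReal.coe_ennreal_top, ← EReal.coe_ennreal_toReal hn, EReal.top_sub_coe]
    exact le_top
  · have hint := integrable_discounted hdm hp hn
    rw [totalUtility_eq h2 hκ0 (fun t _ => hg0 t) hb hint]
    exact_mod_cast integral_mono_ae hi hint hle

end Realization

/-! ### Time shifts of integrals -/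

section Shift

theorem preimage_add_right_Ici (T : ℝ) : (fun t : ℝ => t + T) ⁻¹' Ici T = Ici 0 := by
  ext t; simp

theorem integrableOn_Ici_comp_add {f : ℝ → ℝ} (T : ℝ) :
    IntegrableOn (fun t => f (t + T)) (Ici 0) ↔ IntegrableOn f (Ici T) := by
  have := (measurePreserving_add_right volume T).integrableOn_comp_preimage
    (measurableEmbedding_addRight T) (f := f) (s := Ici T)
  rwa [preimage_add_right_Ici] at this

theorem setIntegral_Ici_comp_add (f : ℝ → ℝ) (T : ℝ) :
    ∫ t in Ici (0 : ℝ), f (t + T) = ∫ t in Ici T, f t := by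
  have := (measurePreserving_add_right volume T).setIntegral_preimage_emb
    (measurableEmbedding_addRight T) f (Ici T)
  rwa [preimage_add_right_Ici] at this

theorem ae_Ici_comp_add {p : ℝ → Prop} (T : ℝ) (h : ∀ᵐ t ∂volume.restrict (Ici T), p t) :
    ∀ᵐ t ∂volume.restrict (Ici (0 : ℝ)), p (t + T) := by
  have := (measurePreserving_add_right volume T).restrict_preimage (measurableSet_Ici (a := T))
  rw [preimage_add_right_Ici] at this
  exact this.quasiMeasurePreserving.ae h

theorem ae_Ici_comp_sub {p : ℝ → Prop} (T : ℝ) (h : ∀ᵐ t ∂volume.restrict (Ici (0 : ℝ)), p t) :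
    ∀ᵐ t ∂volume.restrict (Ici T), p (t - T) := by
  have := (measurePreserving_sub_right volume T).restrict_preimage (measurableSet_Ici (a := (0 : ℝ)))
  have e : (fun t : ℝ => t - T) ⁻¹' Ici 0 = Ici T := by ext t; simp
  rw [e] at this
  exact this.quasiMeasurePreserving.ae h

theorem setIntegral_Ici_eq_add {f : ℝ → ℝ} {T : ℝ} (hT : 0 ≤ T) (hf : IntegrableOn f (Ici 0)) :
    ∫ t in Ici (0 : ℝ), f t = (∫ t in (0 : ℝ)..T, f t) + ∫ t in Ici T, f t := by
  rw [integral_Ici_eq_integral_Ioi, integral_Ici_eq_integral_Ioi,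
    intervalIntegral.integral_of_le hT, ← Ioc_union_Ioi_eq_Ioi hT, setIntegral_union]
  · exact Ioc_disjoint_Ioi le_rfl
  · exact measurableSet_Ioi
  · exact hf.mono_set fun t ht => ht.1.le
  · exact hf.mono_set fun t ht => hT.trans (le_of_lt ht)

theorem intervalIntegral_congr_uIoc {f g : ℝ → ℝ} {a b : ℝ} (h : EqOn f g (uIoc a b)) :
    ∫ t in a..b, f t = ∫ t in a..b, g t :=
  intervalIntegral.integral_congr_ae (Eventually.of_forall fun _ ht => h ht)

theorem integral_exp_neg_mul {ρ : ℝ} (hρ : 0 < ρ) (T : ℝ) :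
    ∫ t in (0 : ℝ)..T, Real.exp (-ρ * t) = (1 - Real.exp (-ρ * T)) / ρ := by
  rw [intervalIntegral.integral_comp_mul_left (fun t => Real.exp t) (by linarith : -ρ ≠ 0)]
  simp
  field_simp
  ring

end Shift

/-- A path of capital and consumption satisfying the integrated equation of motion,
with integrable discounted utility. -/
structure IsPlan (ρ : ℝ) (u : ℝ → ℝ → EReal) (F : ℝ → ℝ → ℝ) (W : Set (ℝ → ℝ))
    (x : ℝ) (k c : ℝ → ℝ) : Prop where
  k_nonneg : ∀ t, 0 ≤ t → 0 ≤ k t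
  c_nonneg : ∀ t, 0 ≤ t → 0 ≤ c t
  intervalIntegrable : ∀ T, 0 ≤ T → IntervalIntegrable (fun t => F (k t) (c t)) volume 0 T
  eq_integral : ∀ t, 0 ≤ t → k t = x + ∫ s in (0 : ℝ)..t, F (k s) (c s)
  bounded_below : W = W₂ → ∀ T, ∃ B, ∀ t ∈ Icc 0 T, B ≤ F (k t) (c t)
  ne_bot : ∀ᵐ t ∂volume.restrict (Ici (0 : ℝ)), u (c t) (k t) ≠ ⊥
  integrable : IntegrableOn (discounted ρ u k c) (Ici 0)

/-- The total discounted utility of a plan. -/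
noncomputable def payoff (ρ : ℝ) (u : ℝ → ℝ → EReal) (k c : ℝ → ℝ) : ℝ :=
  ∫ t in Ici (0 : ℝ), discounted ρ u k c t

/-! ### Plans: approximation of the value, tails, mixtures and concatenation -/

section Plan

variable {ρ : ℝ} {u : ℝ → ℝ → EReal} {F : ℝ → ℝ → ℝ} {W : Set (ℝ → ℝ)} {x : ℝ} {k c : ℝ → ℝ}

theorem IsPlan.initial (h : IsPlan ρ u F W x k c) : k 0 = x := by
  simpa using h.eq_integral 0 le_rfl

theorem IsPlan.continuousOn (h : IsPlan ρ u F W x k c) : ContinuousOn k (Ici 0) :=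
  continuousOn_of_eq_integral h.intervalIntegrable h.eq_integral

theorem IsPlan.ae_coe (h2 : Assumption2 u) (h : IsPlan ρ u F W x k c) :
    ∀ᵐ t ∂volume.restrict (Ici (0 : ℝ)), ((u (c t) (k t)).toReal : EReal) = u (c t) (k t) := by
  filter_upwards [h.ne_bot, ae_restrict_mem measurableSet_Ici] with t ht ht0
  exact EReal.coe_toReal (h2.ne_top _ _ (h.c_nonneg t ht0) (h.k_nonneg t ht0)) ht

/-- A path with finite value may be approximated by plans. -/
theorem exists_isPlan (h1 : Assumption1 ρ W) (h2 : Assumption2 u) (h3 : Assumption3 F W)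
    (hV : valueFunction ρ u F W x ≠ ⊤) {r : ℝ} (hr : (r : EReal) < valueFunction ρ u F W x) :
    ∃ k c, IsPlan ρ u F W x k c ∧ r < payoff ρ u k c := by
  obtain ⟨_, ⟨k, c, hadm, rfl⟩, hlt⟩ := lt_sSup_iff.1 hr
  have hle : totalUtility ρ u k c ≤ valueFunction ρ u F W x := le_sSup ⟨k, c, hadm, rfl⟩
  have htop : totalUtility ρ u k c ≠ ⊤ := ne_top_of_le_ne_top hV hle
  -- Subtracting `⊤` gives `⊥` in `EReal`, even from `⊤`, and `⊥` cannot exceed `r`.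
  have hn : negIntegral ρ u k c ≠ ⊤ := by
    intro hn
    rw [totalUtility, hn, EReal.coe_ennreal_top, sub_eq_add_neg, EReal.neg_top,
      EReal.add_bot] at hlt
    exact not_lt_bot hlt
  have hp : posIntegral ρ u k c ≠ ⊤ := by
    intro hp
    apply htop
    rw [totalUtility, hp, EReal.coe_ennreal_top, ← EReal.coe_ennreal_toReal hn,
      EReal.top_sub_coe]
  have hkc : ContinuousOn k (Ici 0) := by
    intro t ht
    have ht1 : (0 : ℝ) ≤ t + 1 := by linarith [mem_Ici.1 ht]
    have := (hadm.absolutelyContinuous 0 (t + 1) le_rfl ht1).continuousOn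
    rw [uIcc_of_le ht1] at this
    refine (this t ⟨ht, by linarith⟩).mono_of_mem_nhdsWithin ?_
    exact mem_nhdsWithin.2 ⟨Iio (t + 1), isOpen_Iio, by simp, fun s hs => ⟨hs.2, hs.1.le⟩⟩
  have hcm : AEMeasurable c (volume.restrict (Ici 0)) := by
    have hcW := hadm.mem_W
    rcases h1.W_eq with h | h <;> rw [h] at hcW
    · exact hcW.2.aestronglyMeasurable.aemeasurable
    · exact hcW.2.1
  have hum := aemeasurable_utility h2 (hkc.aemeasurable measurableSet_Ici) hcm hadm.k_nonneg
    hadm.c_nonneg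
  have hb := ae_ne_bot_of_negIntegral hum hn
  have hi : IntegrableOn (discounted ρ u k c) (Ici 0) := by
    rw [posIntegral_eq h2 hadm.k_nonneg hadm.c_nonneg hb] at hp
    rw [negIntegral_eq h2 hadm.k_nonneg hadm.c_nonneg hb] at hn
    exact integrable_discounted (aemeasurable_discounted hum) hp hn
  have hderiv : ∀ T, ∀ᵐ t : ℝ, t ∈ uIoc 0 T → 0 ≤ T → deriv k t = F (k t) (c t) := by
    intro T
    filter_upwards [(ae_restrict_iff' measurableSet_Ici).1 hadm.ode] with t ht ht0 hT
    rw [uIoc_of_le hT] at ht0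
    exact (ht ht0.1.le).deriv
  refine ⟨k, c, ⟨hadm.k_nonneg, hadm.c_nonneg, fun T hT => ?_, fun t ht => ?_, fun hW T => ?_,
    hb, hi⟩, ?_⟩
  · refine (hadm.absolutelyContinuous 0 T le_rfl hT).intervalIntegrable_deriv.congr_ae ?_
    rw [EventuallyEq, ae_restrict_iff' measurableSet_uIoc]
    filter_upwards [hderiv T] with t h h' using h h' hT
  · have h := (hadm.absolutelyContinuous 0 t le_rfl ht).integral_deriv_eq_sub
    rw [hadm.initial] at h
    rw [← intervalIntegral.integral_congr_ae (f := deriv k), h]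
    · ring
    · filter_upwards [hderiv t] with s h h' using h h' ht
  · have hcW := hadm.mem_W
    rw [hW] at hcW
    obtain ⟨M, hM⟩ := hcW.2.2 T
    obtain ⟨K, hK⟩ := exists_forall_le hkc T
    obtain ⟨B, hB⟩ := ((isCompact_Icc (a := (0 : ℝ)) (b := K)).prod
      (isCompact_Icc (a := (0 : ℝ)) (b := M))).image_of_continuousOn
      (h3.continuousOn.mono (prod_mono (fun t ht => ht.1) fun t ht => ht.1)) |>.bddBelow
    refine ⟨B, fun t ht => hB ⟨(k t, c t), ⟨⟨hadm.k_nonneg t ht.1, hK t ht⟩,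
      ⟨hadm.c_nonneg t ht.1, hM t ht⟩⟩, rfl⟩⟩
  · rw [totalUtility_eq h2 hadm.k_nonneg hadm.c_nonneg hb hi] at hlt
    exact_mod_cast hlt

/-- What remains of a plan after time `T` is a plan. -/
theorem IsPlan.tail (h : IsPlan ρ u F W x k c) {T : ℝ} (hT : 0 ≤ T) :
    IsPlan ρ u F W (k T) (fun t => k (t + T)) (fun t => c (t + T)) := by
  refine ⟨fun t ht => h.k_nonneg _ (by linarith), fun t ht => h.c_nonneg _ (by linarith),
    fun S hS => ?_, fun t ht => ?_, fun hW S => ?_, ?_, ?_⟩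
  · have := ((h.intervalIntegrable T hT).symm.trans
      (h.intervalIntegrable (S + T) (by linarith))).comp_add_right T
    simpa using this
  · rw [intervalIntegral.integral_comp_add_right (fun t => F (k t) (c t)), h.eq_integral T hT,
      h.eq_integral (t + T) (by linarith), zero_add, add_assoc,
      intervalIntegral.integral_add_adjacent_intervals (h.intervalIntegrable T hT)]
    exact (h.intervalIntegrable T hT).symm.trans (h.intervalIntegrable (t + T) (by linarith))
  · obtain ⟨B, hB⟩ := h.bounded_below hW (S + T)
    exact ⟨B, fun t ht => hB (t + T) ⟨by linarith [ht.1], by linarith [ht.2]⟩⟩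
  · exact ae_Ici_comp_add (p := fun t => u (c t) (k t) ≠ ⊥) T
      (ae_restrict_of_ae_restrict_of_subset (Ici_subset_Ici.2 hT) h.ne_bot)
  · have hi := (integrableOn_Ici_comp_add T).2 (h.integrable.mono_set (Ici_subset_Ici.2 hT))
    refine (hi.const_mul (Real.exp (ρ * T))).congr (Eventually.of_forall fun t => ?_)
    simp only [discounted]
    rw [← mul_assoc, ← Real.exp_add]
    ring_nf

/-- The dynamic programming identity: the tail, seen from time T, is discounted by exp(−ρT). -/
theorem IsPlan.payoff_eq (h : IsPlan ρ u F W x k c) {T : ℝ} (hT : 0 ≤ T) :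
    payoff ρ u k c = (∫ t in (0 : ℝ)..T, discounted ρ u k c t) +
      Real.exp (-ρ * T) * payoff ρ u (fun t => k (t + T)) (fun t => c (t + T)) := by
  rw [payoff, setIntegral_Ici_eq_add hT h.integrable, ← setIntegral_Ici_comp_add, payoff,
    ← integral_const_mul]
  congr 2
  ext t
  simp only [discounted]
  rw [← mul_assoc, ← Real.exp_add]
  ring_nf

/-- Convex combinations of plans bound the value function from below. -/
theorem IsPlan.convex_le (h1 : Assumption1 ρ W) (h2 : Assumption2 u) (h3 : Assumption3 F W)
    {y : ℝ} {k' c' : ℝ → ℝ} (h : IsPlan ρ u F W x k c) (h' : IsPlan ρ u F W y k' c')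
    {a b : ℝ} (ha : 0 < a) (hb : 0 < b) (hab : a + b = 1) :
    ((a * payoff ρ u k c + b * payoff ρ u k' c' : ℝ) : EReal) ≤
      valueFunction ρ u F W (a * x + b * y) := by
  have hi := (h.integrable.const_mul a).add (h'.integrable.const_mul b)
  have key := le_valueFunction h1 h2 h3 (x := a * x + b * y)
    (k := fun t => a * k t + b * k' t) (c := fun t => a * c t + b * c' t)
    (v := fun t => a * F (k t) (c t) + b * F (k' t) (c' t))
    (l := fun t => a * (u (c t) (k t)).toReal + b * (u (c' t) (k' t)).toReal)
    (fun t ht => by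
      have := h.k_nonneg t ht
      have := h'.k_nonneg t ht
      positivity)
    (fun T hT => ((h.intervalIntegrable T hT).const_mul a).add
      ((h'.intervalIntegrable T hT).const_mul b))
    (fun t ht => by
      rw [intervalIntegral.integral_add ((h.intervalIntegrable t ht).const_mul a)
        ((h'.intervalIntegrable t ht).const_mul b), intervalIntegral.integral_const_mul,
        intervalIntegral.integral_const_mul, h.eq_integral t ht, h'.eq_integral t ht]
      ring)
    (fun hW T => by
      obtain ⟨B, hB⟩ := h.bounded_below hW T
      obtain ⟨B', hB'⟩ := h'.bounded_below hW T
      refine ⟨a * B + b * B', fun t ht => ?_⟩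
      have := hB t ht
      have := hB' t ht
      gcongr)
    (fun t ht => by
      have := h.c_nonneg t ht
      have := h'.c_nonneg t ht
      positivity)
    (fun t ht => h3.concave.2
      (show (k t, c t) ∈ Ici (0 : ℝ) ×ˢ Ici (0 : ℝ) from ⟨h.k_nonneg t ht, h.c_nonneg t ht⟩)
      (show (k' t, c' t) ∈ Ici (0 : ℝ) ×ˢ Ici (0 : ℝ) from ⟨h'.k_nonneg t ht, h'.c_nonneg t ht⟩)
      ha.le hb.le hab)
    (by
      filter_upwards [h.ae_coe h2, h'.ae_coe h2, ae_restrict_mem measurableSet_Ici] with t ht ht' ht0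
      have := h2.concave _ _ _ _ a b (h.c_nonneg t ht0) (h.k_nonneg t ht0) (h'.c_nonneg t ht0)
        (h'.k_nonneg t ht0) ha hb hab
      rw [← ht, ← ht'] at this
      exact_mod_cast this)
    (hi.congr (Eventually.of_forall fun t => by
      simp only [Pi.add_apply, discounted]
      ring))
  refine le_trans (le_of_eq ?_) key
  congr 1
  rw [payoff, payoff, ← integral_const_mul, ← integral_const_mul,
    ← integral_add (h.integrable.const_mul a) (h'.integrable.const_mul b)]
  congr 1
  ext t
  simp only [discounted]
  ring

/-- A lower bound for the value function from moving capital at constant speed `v` up to time `T`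
and following a plan afterwards. -/
theorem IsPlan.line_append_le (h1 : Assumption1 ρ W) (h2 : Assumption2 u) (h3 : Assumption3 F W)
    {y v T c₀ w : ℝ} (hT : 0 ≤ T) (h : IsPlan ρ u F W (y + v * T) k c)
    (hy : ∀ t ∈ Icc 0 T, 0 ≤ y + v * t) (hc₀ : 0 ≤ c₀)
    (hv : ∀ t ∈ Icc 0 T, v ≤ F (y + v * t) c₀)
    (hw : ∀ t ∈ Icc 0 T, (w : EReal) ≤ u c₀ (y + v * t)) :
    ((w * ((1 - Real.exp (-ρ * T)) / ρ) + Real.exp (-ρ * T) * payoff ρ u k c : ℝ) : EReal) ≤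
      valueFunction ρ u F W y := by
  -- Time T belongs to the first branch, matching the half-open intervals (0, T] and (T, S] of
  -- interval integrals.
  set f : ℝ → ℝ := fun t => if t ≤ T then v else F (k (t - T)) (c (t - T)) with hf
  set l : ℝ → ℝ := fun t => if t ≤ T then w else (u (c (t - T)) (k (t - T))).toReal with hl
  have hf1 : ∀ S, S ≤ T → 0 ≤ S → EqOn (fun _ => v) f (uIoc 0 S) := fun S hS hS0 t ht => by
    rw [uIoc_of_le hS0] at ht
    simp [hf, ht.2.trans hS]
  have hf2 : ∀ S, T ≤ S → EqOn (fun t => F (k (t - T)) (c (t - T))) f (uIoc T S) :=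
    fun S hS t ht => by
      rw [uIoc_of_le hS] at ht
      simp [hf, not_le.2 ht.1]
  have hi1 : ∀ S, S ≤ T → 0 ≤ S → IntervalIntegrable f volume 0 S := fun S hS hS0 =>
    intervalIntegrable_const.congr (hf1 S hS hS0)
  have hi2 : ∀ S, T ≤ S → IntervalIntegrable f volume T S := fun S hS => by
    have := (h.intervalIntegrable (S - T) (by linarith)).comp_sub_right T
    simp only [zero_add, sub_add_cancel] at this
    exact this.congr (hf2 S hS)
  have hexp : ∀ t, Real.exp (-ρ * (t + T)) = Real.exp (-ρ * T) * Real.exp (-ρ * t) := fun t => by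
    rw [← Real.exp_add]; ring_nf
  have hl1 : EqOn (fun t => Real.exp (-ρ * t) * w) (fun t => Real.exp (-ρ * t) * l t) (uIoc 0 T) :=
    fun t ht => by
      rw [uIoc_of_le hT] at ht
      simp [hl, ht.2]
  have hl2 : ∀ᵐ t ∂volume.restrict (Ici (0 : ℝ)), Real.exp (-ρ * T) * discounted ρ u k c t =
      Real.exp (-ρ * (t + T)) * l (t + T) := by
    rw [← restrict_Ioi_eq_restrict_Ici]
    filter_upwards [ae_restrict_mem measurableSet_Ioi] with t ht
    have : ¬ t + T ≤ T := by linarith [mem_Ioi.1 ht]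
    simp only [hl, this, if_false, discounted, add_sub_cancel_right, hexp]
    ring
  have hint2 : IntegrableOn (fun t => Real.exp (-ρ * t) * l t) (Ici T) := by
    rw [← integrableOn_Ici_comp_add]
    exact (h.integrable.const_mul (Real.exp (-ρ * T))).congr hl2
  have hint1 : IntervalIntegrable (fun t => Real.exp (-ρ * t) * l t) volume 0 T :=
    (Continuous.intervalIntegrable (by fun_prop) 0 T).congr hl1
  have hint : IntegrableOn (fun t => Real.exp (-ρ * t) * l t) (Ici 0) := by
    rw [intervalIntegrable_iff_integrableOn_Icc_of_le hT] at hint1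
    refine (hint1.union hint2).mono_set fun t ht => ?_
    rcases le_total t T with h | h
    · exact Or.inl ⟨ht, h⟩
    · exact Or.inr h
  have key := le_valueFunction h1 h2 h3 (x := y) (v := f) (l := l)
    (k := fun t => if t ≤ T then y + v * t else k (t - T))
    (c := fun t => if t ≤ T then c₀ else c (t - T))
    (fun t ht => by
      split_ifs with htT
      · exact hy t ⟨ht, htT⟩
      · exact h.k_nonneg _ (by linarith))
    (fun S hS => by
      rcases le_total S T with hST | hST
      · exact hi1 S hST hS
      · exact (hi1 T le_rfl hT).trans (hi2 S hST))
    (fun t ht => by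
      split_ifs with htT
      · rw [← intervalIntegral_congr_uIoc (hf1 t htT ht)]
        simp [mul_comm]
      · have htT' : T ≤ t := by linarith
        rw [← intervalIntegral.integral_add_adjacent_intervals (hi1 T le_rfl hT) (hi2 t htT'),
          ← intervalIntegral_congr_uIoc (hf1 T le_rfl hT),
          ← intervalIntegral_congr_uIoc (hf2 t htT'),
          intervalIntegral.integral_comp_sub_right (fun t => F (k t) (c t)),
          h.eq_integral (t - T) (by linarith)]
        simp
        ring)
    (fun hW S => by
      obtain ⟨B, hB⟩ := h.bounded_below hW S
      refine ⟨min v B, fun t ht => ?_⟩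
      simp only [hf]
      split_ifs with htT
      · exact min_le_left _ _
      · exact (min_le_right _ _).trans (hB (t - T) ⟨by linarith, by linarith [ht.2]⟩))
    (fun t ht => by
      split_ifs with htT
      · exact hc₀
      · exact h.c_nonneg _ (by linarith))
    (fun t ht => by
      simp only [hf]
      split_ifs with htT
      · exact hv t ⟨ht, htT⟩
      · exact le_rfl)
    (by
      have := ae_Ici_comp_sub T (h.ae_coe h2)
      rw [ae_restrict_iff' measurableSet_Ici] at this ⊢
      filter_upwards [this] with t ht ht0
      simp only [hl]
      split_ifs with htT
      · exact hw t ⟨ht0, htT⟩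
      · exact (ht (le_of_lt (not_le.1 htT))).le)
    hint
  refine le_trans (le_of_eq ?_) key
  congr 1
  rw [setIntegral_Ici_eq_add hT hint, ← intervalIntegral_congr_uIoc hl1,
    ← setIntegral_Ici_comp_add, ← integral_congr_ae hl2, integral_const_mul,
    intervalIntegral.integral_mul_const, integral_exp_neg_mul h1.rho_pos, payoff]
  ring

end Plan

/-! ### Supergradients of concave functions on the half-line -/

section Supergradient

/-- `p` is a supergradient at `x` of the function `f` on `(0, ∞)`. -/
def IsSupergradient (f : ℝ → ℝ) (x p : ℝ) : Prop := ∀ y, 0 < y → f y ≤ f x + p * (y - x)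

variable {f : ℝ → ℝ} {x p : ℝ}

theorem isSupergradient_of_hasDerivAt (hf : ConcaveOn ℝ (Ioi 0) f) (hx : 0 < x)
    (h : HasDerivAt f p x) : IsSupergradient f x p := by
  intro y hy
  rcases lt_trichotomy y x with hyx | rfl | hyx
  · have := hf.le_slope_of_hasDerivAt hy hx hyx h
    rw [slope_def_field, le_div_iff₀ (by linarith)] at this
    linarith
  · simp
  · have := hf.slope_le_of_hasDerivAt hx hy hyx h
    rw [slope_def_field, div_le_iff₀ (by linarith)] at this
    linarith

theorem isSupergradient_oneSided (hf : ConcaveOn ℝ (Ioi 0) f) (hx : 0 < x) :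
    IsSupergradient f x (-derivWithin (-f) (Ioi x) x) ∧
      IsSupergradient f x (-derivWithin (-f) (Iio x) x) := by
  have hg : ConvexOn ℝ (Ioi 0) (-f) := hf.neg
  have hxi : x ∈ interior (Ioi (0 : ℝ)) := by rwa [interior_Ioi]
  have hlr := hg.leftDeriv_le_rightDeriv_of_mem_interior hxi
  have hbelow : ∀ y, 0 < y → y < x →
      -f x + f y ≤ derivWithin (-f) (Iio x) x * (x - y) := fun y hy hyx => by
    have := hg.slope_le_leftDeriv_of_mem_interior hy hxi hyx
    rw [slope_def_field, div_le_iff₀ (by linarith)] at this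
    simp only [Pi.neg_apply] at this
    linarith
  have habove : ∀ y, x < y → derivWithin (-f) (Ioi x) x * (y - x) ≤ -f y + f x := fun y hyx => by
    have := hg.rightDeriv_le_slope_of_mem_interior hxi (hx.trans hyx) hyx
    rw [slope_def_field, le_div_iff₀ (by linarith)] at this
    simp only [Pi.neg_apply] at this
    linarith
  constructor <;> intro y hy <;> rcases lt_trichotomy y x with h | h | h
  · nlinarith [hbelow y hy h]
  · simp [h]
  · linarith [habove y h]
  · linarith [hbelow y hy h]
  · simp [h]
  · nlinarith [habove y h]

theorem exists_isSupergradient (hf : ConcaveOn ℝ (Ioi 0) f) (hx : 0 < x) :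
    ∃ p, IsSupergradient f x p :=
  ⟨_, (isSupergradient_oneSided hf hx).1⟩

theorem hasDerivAt_of_unique_supergradient (hf : ConcaveOn ℝ (Ioi 0) f) (hx : 0 < x)
    (hu : ∀ p q, IsSupergradient f x p → IsSupergradient f x q → p = q)
    (hp : IsSupergradient f x p) : HasDerivAt f p x := by
  obtain ⟨hr, hl⟩ := isSupergradient_oneSided hf hx
  have hg : ConvexOn ℝ (Ioi 0) (-f) := hf.neg
  have hxi : x ∈ interior (Ioi (0 : ℝ)) := by rwa [interior_Ioi]
  have h1 := hg.hasDerivWithinAt_rightDeriv_of_mem_interior hxi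
  have h2 := hg.hasDerivWithinAt_leftDeriv_of_mem_interior hxi
  have e1 := hu _ _ hr hp
  have e2 := hu _ _ hl hp
  rw [show derivWithin (-f) (Ioi x) x = -p by linarith] at h1
  rw [show derivWithin (-f) (Iio x) x = -p by linarith] at h2
  have h : HasDerivAt (-f) (-p) x := by
    rw [hasDerivWithinAt_iff_tendsto_slope' (by simp)] at h1 h2
    exact hasDerivAt_iff_tendsto_slope_left_right.2 ⟨h2, h1⟩
  simpa using h.neg

/-- Differentiability of a concave function already gives continuity of its derivative: the secant
slope from y to a fixed z bounds f'(y) on one side, depends continuously on y, and is close to f'(x)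
when y = x and z is near x. -/
theorem contDiffOn_of_unique_supergradient (hf : ConcaveOn ℝ (Ioi 0) f)
    (hu : ∀ x, 0 < x → ∀ p q, IsSupergradient f x p → IsSupergradient f x q → p = q) :
    ContDiffOn ℝ 1 f (Ioi 0) := by
  have hd : ∀ x, 0 < x → HasDerivAt f (deriv f x) x := fun x hx => by
    obtain ⟨p, hp⟩ := exists_isSupergradient hf hx
    have := hasDerivAt_of_unique_supergradient hf hx (hu x hx) hp
    rwa [this.deriv]
  have hs : ∀ x, 0 < x → IsSupergradient f x (deriv f x) := fun x hx =>
    isSupergradient_of_hasDerivAt hf hx (hd x hx)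
  have hslope : ∀ x, 0 < x → ∀ z, z ≠ x →
      Tendsto (fun y => (f z - f y) / (z - y)) (𝓝 x) (𝓝 ((f z - f x) / (z - x))) :=
    fun x hx z hz => (tendsto_const_nhds.sub (hd x hx).continuousAt).div
      (tendsto_const_nhds.sub tendsto_id) (sub_ne_zero.2 hz)
  rw [contDiffOn_one_iff_derivWithin isOpen_Ioi.uniqueDiffOn]
  refine ⟨fun x hx => (hd x hx).differentiableAt.differentiableWithinAt,
    ContinuousOn.congr (f := deriv f) (fun x hx => ?_)
      fun x hx => derivWithin_of_isOpen isOpen_Ioi hx⟩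
  have hx : 0 < x := hx
  refine ContinuousAt.continuousWithinAt (tendsto_order.2 ⟨fun a ha => ?_, fun a ha => ?_⟩)
  · obtain ⟨z, hz1, hz2⟩ : ∃ z, a < (f z - f x) / (z - x) ∧ x < z := by
      have h := (hasDerivAt_iff_tendsto_slope_left_right.1 (hd x hx)).2
      obtain ⟨z, h1, h2⟩ := ((h.eventually_const_lt ha).and self_mem_nhdsWithin).exists
      exact ⟨z, by rwa [slope_def_field] at h1, h2⟩
    filter_upwards [(hslope x hx z hz2.ne').eventually_const_lt hz1, eventually_lt_nhds hz2,
      eventually_gt_nhds hx] with y h1 h2 h3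
    have := hs y h3 z (hx.trans hz2)
    rw [lt_div_iff₀ (by linarith)] at h1
    nlinarith
  · obtain ⟨z, hz1, hz2, hz3⟩ : ∃ z, (f z - f x) / (z - x) < a ∧ z < x ∧ 0 < z := by
      have h := (hasDerivAt_iff_tendsto_slope_left_right.1 (hd x hx)).1
      have h' : ∀ᶠ z in 𝓝[<] x, z < x ∧ 0 < z :=
        eventually_mem_nhdsWithin.and (nhdsWithin_le_nhds (eventually_gt_nhds hx))
      obtain ⟨z, h1, h2, h3⟩ := ((h.eventually_lt_const ha).and h').exists
      exact ⟨z, by rwa [slope_def_field] at h1, h2, h3⟩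
    filter_upwards [(hslope x hx z hz2.ne).eventually_lt_const hz1, eventually_gt_nhds hz2] with
      y h1 h2
    have := hs y (hz3.trans h2) z hz3
    rw [div_lt_iff_of_neg (by linarith)] at h1
    nlinarith

end Supergradient

/-- The standing assumptions of the growth model, with a finite value function. -/
structure Standing (ρ : ℝ) (u : ℝ → ℝ → EReal) (F : ℝ → ℝ → ℝ) (W : Set (ℝ → ℝ)) : Prop where
  a1 : Assumption1 ρ W
  a2 : Assumption2 u
  a3 : Assumption3 F W
  a4 : Assumption4 u
  finite : IsFinite (valueFunction ρ u F W)

/-- The value function as a real function. -/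
noncomputable def value (ρ : ℝ) (u : ℝ → ℝ → EReal) (F : ℝ → ℝ → ℝ) (W : Set (ℝ → ℝ)) (k : ℝ) : ℝ :=
  (valueFunction ρ u F W k).toReal

/-! ### Concavity of the value function -/

section Value

variable {ρ : ℝ} {u : ℝ → ℝ → EReal} {F : ℝ → ℝ → ℝ} {W : Set (ℝ → ℝ)}

theorem Standing.coe_value (h : Standing ρ u F W) {x : ℝ} (hx : 0 < x) :
    (value ρ u F W x : EReal) = valueFunction ρ u F W x :=
  EReal.coe_toReal (h.finite x hx).2 (h.finite x hx).1

theorem Standing.exists_plan (h : Standing ρ u F W) {x r : ℝ} (hx : 0 < x)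
    (hr : r < value ρ u F W x) : ∃ k c, IsPlan ρ u F W x k c ∧ r < payoff ρ u k c :=
  exists_isPlan h.a1 h.a2 h.a3 (h.finite x hx).2
    (by rw [← h.coe_value hx]; exact_mod_cast hr)

theorem Standing.convex_le (h : Standing ρ u F W) {x y a b : ℝ} {k c k' c' : ℝ → ℝ}
    (hp : IsPlan ρ u F W x k c) (hp' : IsPlan ρ u F W y k' c') (ha : 0 < a) (hb : 0 < b)
    (hab : a + b = 1) (hxy : 0 < a * x + b * y) :
    a * payoff ρ u k c + b * payoff ρ u k' c' ≤ value ρ u F W (a * x + b * y) := by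
  have := hp.convex_le h.a1 h.a2 h.a3 hp' ha hb hab
  rw [← h.coe_value hxy] at this
  exact_mod_cast this

theorem Standing.concaveOn_value (h : Standing ρ u F W) :
    ConcaveOn ℝ (Ioi 0) (value ρ u F W) := by
  refine concaveOn_iff_forall_pos.2 ⟨convex_Ioi 0, fun x hx y hy a b ha hb hab => ?_⟩
  have hx : 0 < x := hx
  have hy : 0 < y := hy
  simp only [smul_eq_mul]
  refine le_of_forall_pos_le_add fun ε hε => ?_
  obtain ⟨k, c, hp, hr⟩ := h.exists_plan hx (sub_lt_self _ hε)
  obtain ⟨k', c', hp', hr'⟩ := h.exists_plan hy (sub_lt_self _ hε)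
  have := h.convex_le hp hp' ha hb hab (by positivity)
  nlinarith

/-- A supergradient of the value function bounds the payoff of all plans, including those
which start without capital. -/
theorem Standing.payoff_le (h : Standing ρ u F W) {x p y : ℝ}
    (hp : IsSupergradient (value ρ u F W) x p) {k c : ℝ → ℝ} (hy : 0 ≤ y)
    (hk : IsPlan ρ u F W y k c) : payoff ρ u k c ≤ value ρ u F W x + p * (y - x) := by
  -- The supergradient inequality says nothing at y = 0, where a tail may start. Mixing in a little
  -- of a plan starting from 1 gives positive initial capital; the weight then tends to 0.
  obtain ⟨k', c', hp', -⟩ := h.exists_plan one_pos (sub_one_lt _)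
  have hlim : Tendsto (fun s : ℝ => (1 - s) * payoff ρ u k c + s * payoff ρ u k' c') (𝓝[>] 0)
      (𝓝 (payoff ρ u k c)) := by
    have : Continuous (fun s : ℝ => (1 - s) * payoff ρ u k c + s * payoff ρ u k' c') := by fun_prop
    simpa using (this.tendsto 0).mono_left (nhdsWithin_le_nhds (s := Ioi 0))
  have hlim' : Tendsto (fun s : ℝ => value ρ u F W x + p * ((1 - s) * y + s * 1 - x)) (𝓝[>] 0)
      (𝓝 (value ρ u F W x + p * (y - x))) := by
    have : Continuous (fun s : ℝ => value ρ u F W x + p * ((1 - s) * y + s * 1 - x)) := by fun_prop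
    simpa using (this.tendsto 0).mono_left (nhdsWithin_le_nhds (s := Ioi 0))
  refine le_of_tendsto_of_tendsto hlim hlim' ?_
  filter_upwards [Ioo_mem_nhdsGT (zero_lt_one' ℝ)] with s hs
  have hpos : 0 < (1 - s) * y + s * 1 := by
    have := mul_nonneg (sub_nonneg.2 hs.2.le) hy
    linarith [hs.1]
  exact (h.convex_le hk hp' (sub_pos.2 hs.2) hs.1 (by ring) hpos).trans (hp _ hpos)

end Value

theorem tendsto_discount_div {ρ : ℝ} (hρ : 0 < ρ) :
    Tendsto (fun T : ℝ => (1 - Real.exp (-ρ * T)) / ρ / T) (𝓝[>] 0) (𝓝 1) := by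
  have h : HasDerivAt (fun T : ℝ => (1 - Real.exp (-ρ * T)) / ρ) 1 0 := by
    have h1 : HasDerivAt (fun T : ℝ => -ρ * T) (-ρ) 0 := by
      simpa using (hasDerivAt_id (0 : ℝ)).const_mul (-ρ)
    convert! (h1.exp.const_sub 1).div_const ρ using 1
    simp
    field_simp
  have := (hasDerivAt_iff_tendsto_slope_left_right.1 h).2
  refine this.congr fun T => ?_
  simp [slope_def_field]

/-! ### The inequality H ≤ ρV and positivity of supergradients -/

section

variable {ρ : ℝ} {u : ℝ → ℝ → EReal} {F : ℝ → ℝ → ℝ} {W : Set (ℝ → ℝ)}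

/-- Every supergradient of the value function is a supersolution of the HJB equation. -/
theorem Standing.hamiltonian_le (h : Standing ρ u F W) {x p c : ℝ} (hx : 0 < x) (hc : 0 < c)
    (hp : IsSupergradient (value ρ u F W) x p) :
    F x c * p + (u c x).toReal ≤ ρ * value ρ u F W x := by
  have hρ := h.a1.rho_pos
  set v := F x c with hv
  refine le_of_forall_lt_imp_le_of_dense fun r hr => ?_
  obtain ⟨w, hw, hwr⟩ : ∃ w, w < (u c x).toReal ∧ r = v * p + w := ⟨r - v * p, by linarith, by ring⟩
  subst hwr
  -- Consuming slightly less than `c` makes the speed `v` strictly feasible at x, hence also at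
  -- nearby capital, while utility stays above `w`.
  obtain ⟨c', hwc', hc'0, hc'c⟩ : ∃ c', w < (u c' x).toReal ∧ 0 < c' ∧ c' < c := by
    have h1 : ∀ᶠ c' in 𝓝[<] c, w < (u c' x).toReal :=
      ((h.a2.hasDerivAt hc hx).continuousAt.tendsto.mono_left nhdsWithin_le_nhds).eventually_const_lt
        hw
    have h2 : ∀ᶠ c' in 𝓝[<] c, 0 < c' ∧ c' < c :=
      ((eventually_gt_nhds hc).filter_mono nhdsWithin_le_nhds).and eventually_mem_nhdsWithin
    exact (h1.and h2).exists
  have hvc' : v < F x c' := h.a3.decreasing x hx.le hc'0.le hc.le hc'c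
  have hnear : ∀ᶠ z in 𝓝 x, 0 < z ∧ v < F z c' ∧ w < (u c' z).toReal := by
    have hF : ContinuousAt (fun z => F z c') x :=
      (h.a3.continuousOn_left hc'0.le).continuousAt (Ici_mem_nhds hx)
    have hu : ContinuousAt (fun z => (u c' z).toReal) x := by
      have := h.a2.contDiffOn.continuousOn.continuousAt ((isOpen_Ioi.prod isOpen_Ioi).mem_nhds
        (show (c', x) ∈ Ioi (0 : ℝ) ×ˢ Ioi (0 : ℝ) from ⟨hc'0, hx⟩))
      exact ContinuousAt.comp (f := fun z : ℝ => (c', z))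
        (g := fun y : ℝ × ℝ => (u y.1 y.2).toReal) this (by fun_prop)
    exact (eventually_gt_nhds hx).and
      ((hF.eventually_const_lt hvc').and (hu.eventually_const_lt hwc'))
  obtain ⟨δ, hδ, hball⟩ := Metric.eventually_nhds_iff.1 hnear
  have hTsmall : ∀ᶠ T in 𝓝[>] (0 : ℝ), |v| * T < δ := by
    have : Tendsto (fun T : ℝ => |v| * T) (𝓝[>] 0) (𝓝 0) := by
      have : Continuous (fun T : ℝ => |v| * T) := by fun_prop
      simpa using (this.tendsto 0).mono_left (nhdsWithin_le_nhds (s := Ioi 0))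
    exact this.eventually_lt_const hδ
  have hlim := tendsto_discount_div hρ
  refine le_of_tendsto_of_tendsto ((hlim.const_mul w).const_add (v * p))
    (hlim.const_mul (ρ * value ρ u F W x)) ?_ |>.trans_eq' (by ring) |>.trans_eq (by ring)
  filter_upwards [hTsmall, self_mem_nhdsWithin] with T hTδ hT
  have hT : 0 < T := hT
  have hz : ∀ t ∈ Icc 0 T, dist (x - v * T + v * t) x < δ := fun t ht => by
    rw [Real.dist_eq, show x - v * T + v * t - x = -(v * (T - t)) by ring, abs_neg, abs_mul,
      abs_of_nonneg (by linarith [ht.2] : 0 ≤ T - t)]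
    refine lt_of_le_of_lt ?_ hTδ
    gcongr
    linarith [ht.1]
  have hy0 : 0 < x - v * T := by
    simpa using (hball (hz 0 ⟨le_rfl, hT.le⟩)).1
  set e := Real.exp (-ρ * T) with he
  have he0 : 0 < e := Real.exp_pos _
  -- Move from x − vT to x, then follow a nearly optimal plan from x.
  have hVy : w * ((1 - e) / ρ) + e * value ρ u F W x ≤ value ρ u F W (x - v * T) := by
    refine le_of_forall_pos_le_add fun ε hε => ?_
    obtain ⟨k, κ, hk, hval⟩ := h.exists_plan hx
      (sub_lt_self (value ρ u F W x) (div_pos hε he0))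
    have hk' : IsPlan ρ u F W (x - v * T + v * T) k κ := by rwa [sub_add_cancel]
    have key := hk'.line_append_le h.a1 h.a2 h.a3 hT.le
      (fun t ht => (hball (hz t ht)).1.le) hc'0.le (fun t ht => (hball (hz t ht)).2.1.le)
      (w := w) (fun t ht => by
        obtain ⟨h1, -, h3⟩ := hball (hz t ht)
        rw [← h.a2.coe_toReal hc'0 h1]
        exact_mod_cast h3.le)
    rw [← h.coe_value hy0] at key
    have key := EReal.coe_le_coe_iff.1 key
    have : e * (value ρ u F W x - ε / e) = e * value ρ u F W x - ε := by
      field_simp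
    have := mul_le_mul_of_nonneg_left hval.le he0.le
    linarith
  have hsup := hp (x - v * T) hy0
  have hfin : v * p * T + w * ((1 - e) / ρ) ≤ ρ * value ρ u F W x * ((1 - e) / ρ) := by
    have : ρ * value ρ u F W x * ((1 - e) / ρ) = value ρ u F W x * (1 - e) := by
      field_simp
    rw [this]
    linarith
  calc v * p + w * ((1 - e) / ρ / T) = (v * p * T + w * ((1 - e) / ρ)) / T := by field_simp
    _ ≤ (ρ * value ρ u F W x * ((1 - e) / ρ)) / T := by gcongr
    _ = _ := by ring

/-- Utility −∞ occurs only on a null set; there `toReal` would return 0, so the pointwise bound is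
required only elsewhere. -/
theorem IsPlan.integral_discounted_le {x T : ℝ} {k c φ : ℝ → ℝ} (hp : IsPlan ρ u F W x k c)
    (hT : 0 ≤ T) (hφ : IntervalIntegrable φ volume 0 T)
    (hle : ∀ t, 0 ≤ t → t ≤ T → u (c t) (k t) ≠ ⊥ → discounted ρ u k c t ≤ φ t) :
    ∫ t in (0 : ℝ)..T, discounted ρ u k c t ≤ ∫ t in (0 : ℝ)..T, φ t := by
  have hsub : Icc 0 T ⊆ Ici (0 : ℝ) := fun t ht => ht.1
  refine intervalIntegral.integral_mono_ae_restrict hT ?_ hφ ?_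
  · rw [intervalIntegrable_iff_integrableOn_Icc_of_le hT]
    exact hp.integrable.mono_set hsub
  · filter_upwards [ae_restrict_of_ae_restrict_of_subset hsub hp.ne_bot,
      ae_restrict_mem measurableSet_Icc] with t ht ht' using hle t ht'.1 ht'.2 ht

/-- Along any plan capital stays bounded for a short time. -/
theorem IsPlan.le_of_growth {x T A : ℝ} {k c : ℝ → ℝ} (hp : IsPlan ρ u F W x k c)
    (hA : 0 < A) (hF : ∀ k c, 0 ≤ k → 0 ≤ c → F k c ≤ A * (1 + k)) (hT : 0 ≤ T)
    (hAT : A * T ≤ 1 / 2) : ∀ t ∈ Icc 0 T, k t ≤ 2 * (x + A * T) := by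
  -- At a maximum point s of k on [0, T], k(s) ≤ x + AT(1 + k(s)), and AT ≤ 1/2 absorbs the last
  -- term.
  obtain ⟨s, hs, hmax⟩ := isCompact_Icc.exists_isMaxOn ⟨0, left_mem_Icc.2 hT⟩
    (hp.continuousOn.mono fun t (ht : t ∈ Icc 0 T) => ht.1)
  have hmax : ∀ t ∈ Icc 0 T, k t ≤ k s := fun t ht => hmax ht
  have h1 : ∫ t in (0 : ℝ)..s, F (k t) (c t) ≤ ∫ _ in (0 : ℝ)..s, A * (1 + k s) := by
    refine intervalIntegral.integral_mono_on hs.1 (hp.intervalIntegrable s hs.1) (by simp)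
      fun t ht => ?_
    refine (hF _ _ (hp.k_nonneg t ht.1) (hp.c_nonneg t ht.1)).trans ?_
    have := hmax t ⟨ht.1, ht.2.trans hs.2⟩
    gcongr
  rw [intervalIntegral.integral_const, smul_eq_mul, sub_zero] at h1
  have h2 := hp.eq_integral s hs.1
  have h3 : 0 ≤ A * (1 + k s) := by
    have := hp.k_nonneg s hs.1
    positivity
  have h4 : s * (A * (1 + k s)) ≤ T * (A * (1 + k s)) := mul_le_mul_of_nonneg_right hs.2 h3
  have h5 : (A * T) * k s ≤ 1 / 2 * k s := mul_le_mul_of_nonneg_right hAT (hp.k_nonneg s hs.1)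
  intro t ht
  have := hmax t ht
  nlinarith

/-- At a negative price, raising consumption without bound sends F(x, c)p to +∞, against
`Standing.hamiltonian_le`. -/
theorem Standing.supergradient_nonneg (h : Standing ρ u F W) {x p : ℝ} (hx : 0 < x)
    (hp : IsSupergradient (value ρ u F W) x p) : 0 ≤ p := by
  by_contra! hneg
  obtain ⟨A, m, hm, hb⟩ := h.a3.exists_linear_bound x
  set B := (ρ * value ρ u F W x - (u 1 x).toReal - p * A + 1) / (-p * m)
  set c := max 1 B
  have hc1 : 1 ≤ c := le_max_left _ _
  have hc2 : B ≤ c := le_max_right _ _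
  have hpm : 0 < -p * m := by nlinarith
  rw [div_le_iff₀ hpm] at hc2
  have h1 := h.hamiltonian_le hx (by linarith : 0 < c) hp
  have h2 := h.a2.toReal_le one_pos hx hc1 le_rfl
  have h3 := hb x c hx.le le_rfl (by linarith)
  nlinarith

/-- If the value function has a critical point, then its value there bounds the utility. -/
theorem Standing.utility_le_of_critical (h : Standing ρ u F W) {x : ℝ} (hx : 0 < x)
    (hp : IsSupergradient (value ρ u F W) x 0) {c k : ℝ} (hc : 0 < c) (hk : 0 < k) :
    (u c k).toReal ≤ ρ * value ρ u F W x := by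
  rcases le_or_gt k x with hkx | hkx
  · have := h.hamiltonian_le hx hc hp
    have := h.a2.toReal_le hc hk le_rfl hkx
    linarith
  · obtain ⟨q, hq⟩ := exists_isSupergradient h.concaveOn_value hk
    have hq0 := h.supergradient_nonneg hk hq
    have h1 := hq x hx
    have h2 := hp k hk
    have hq1 : q = 0 := by
      by_contra hne
      have : 0 < q * (k - x) := mul_pos (lt_of_le_of_ne hq0 (Ne.symm hne)) (by linarith)
      linarith
    have := h.hamiltonian_le hk hc hq
    rw [hq1] at this
    have := mul_le_mul_of_nonneg_left h2 h.a1.rho_pos.le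
    linarith

/-- With p = 0, S = ρV(x) bounds utility everywhere and V(x) bounds every tail, so a nearly optimal
plan must keep utility close to S on [0, T]. But its capital is bounded there, hence so is its
average consumption; by concavity its utility stays below u(C, K) < S on average. -/
theorem Standing.supergradient_pos (h : Standing ρ u F W) {x p : ℝ} (hx : 0 < x)
    (hp : IsSupergradient (value ρ u F W) x p) : 0 < p := by
  rcases (h.supergradient_nonneg hx hp).lt_or_eq with hlt | heq
  · exact hlt
  subst heq
  exfalso
  have hρ := h.a1.rho_pos
  obtain ⟨A, hA, hF⟩ := h.a3.exists_growth_bound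
  set T := 1 / (2 * A) with hTdef
  have hT : 0 < T := by positivity
  have hAT : A * T ≤ 1 / 2 := le_of_eq (by rw [hTdef]; field_simp)
  set K := 2 * (x + A * T) with hK
  have hK0 : 0 < K := by positivity
  obtain ⟨B, m, hm, hb⟩ := h.a3.exists_linear_bound K
  -- |B| + x/T bounds the average of B − F, since k(T) ≥ 0; divided by m it bounds average
  -- consumption. The 1 matches the shift of c to c + 1 below, which keeps the tangent bound away
  -- from zero consumption.
  set C := (|B| + x / T) / m + 1 with hC
  have hC0 : 0 < C := by positivity
  set D := du_dc u C K with hD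
  have hD0 : 0 < D := du_dc_pos h.a2 hC0 hK0
  set S := ρ * value ρ u F W x with hS
  have hSC : (u C K).toReal < S :=
    (h.a2.toReal_lt hC0 hK0 (lt_add_one C)).trans_le
      (h.utility_le_of_critical hx hp (by linarith) hK0)
  set e := Real.exp (-ρ * T) with he
  have he0 : 0 < e := Real.exp_pos _
  obtain ⟨k, c, hk, hval⟩ := h.exists_plan hx
    (sub_lt_self (value ρ u F W x) (mul_pos (mul_pos he0 hT) (sub_pos.2 hSC)))
  have hkK := hk.le_of_growth hA hF hT.le hAT
  have hFi := hk.intervalIntegrable T hT.le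
  have htail := h.payoff_le hp (hk.k_nonneg T hT.le) (hk.tail hT.le)
  rw [hk.payoff_eq hT.le] at hval
  have hφi : IntervalIntegrable (fun t => Real.exp (-ρ * t) * S) volume 0 T :=
    Continuous.intervalIntegrable (by fun_prop) 0 T
  have hψi : IntervalIntegrable (fun t => (B - F (k t) (c t)) / m + 1 - C) volume 0 T :=
    (((intervalIntegrable_const.sub hFi).div_const m).add intervalIntegrable_const).sub
      intervalIntegrable_const
  have hχi : IntervalIntegrable (fun t => e * (S - (u C K).toReal -
      D * ((B - F (k t) (c t)) / m + 1 - C))) volume 0 T :=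
    (intervalIntegrable_const.sub (hψi.const_mul D)).const_mul e
  have hint := hk.integral_discounted_le hT.le (hφi.sub hχi) fun t ht0 htT hbot => by
    have hct := hk.c_nonneg t ht0
    have hkt := hk.k_nonneg t ht0
    have hc1 : 0 < c t + 1 := by linarith
    have h1 : (u (c t) (k t)).toReal ≤ (u (c t + 1) K).toReal := by
      have := h.a2.nondecreasing (c t) (k t) (c t + 1) K hct hkt (by linarith) (hkK t ⟨ht0, htT⟩)
      rw [← EReal.coe_toReal (h.a2.ne_top _ _ hct hkt) hbot, ← h.a2.coe_toReal hc1 hK0] at this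
      exact_mod_cast this
    have h2 := h.a2.le_tangent hc1 hC0 hK0
    have h3 : c t ≤ (B - F (k t) (c t)) / m := by
      rw [le_div_iff₀ hm]
      have := hb (k t) (c t) hkt (hkK t ⟨ht0, htT⟩) hct
      linarith
    have h4 : D * (c t + 1 - C) ≤ D * ((B - F (k t) (c t)) / m + 1 - C) := by gcongr
    have h5 := h.utility_le_of_critical hx hp hc1 hK0
    have h6 : e ≤ Real.exp (-ρ * t) := Real.exp_le_exp.2 (by nlinarith)
    have h7 : e * (S - (u (c t + 1) K).toReal) ≤
        Real.exp (-ρ * t) * (S - (u (c t) (k t)).toReal) :=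
      mul_le_mul h6 (by linarith) (by linarith) (Real.exp_pos _).le
    have h8 : e * (S - (u C K).toReal - D * ((B - F (k t) (c t)) / m + 1 - C)) ≤
        e * (S - (u (c t + 1) K).toReal) := by
      refine mul_le_mul_of_nonneg_left ?_ he0.le
      linarith
    simp only [discounted]
    linarith
  have hψ : ∫ t in (0 : ℝ)..T, ((B - F (k t) (c t)) / m + 1 - C) ≤ 0 := by
    rw [intervalIntegral.integral_sub (((intervalIntegrable_const.sub hFi).div_const m).add
      intervalIntegrable_const) intervalIntegrable_const, intervalIntegral.integral_add
      ((intervalIntegrable_const.sub hFi).div_const m) intervalIntegrable_const,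
      intervalIntegral.integral_div, intervalIntegral.integral_sub intervalIntegrable_const hFi]
    have h1 := hk.eq_integral T hT.le
    have h2 := hk.k_nonneg T hT.le
    have h3 : (B * T - ∫ t in (0 : ℝ)..T, F (k t) (c t)) / m ≤ (|B| * T + x) / m := by
      have := mul_le_mul_of_nonneg_right (le_abs_self B) hT.le
      gcongr
      linarith
    have h4 : (|B| * T + x) / m + T - C * T = 0 := by
      rw [hC]
      field_simp
      ring
    simp only [intervalIntegral.integral_const, smul_eq_mul, sub_zero, mul_one]
    rw [mul_comm T B, mul_comm T C]
    linarith
  rw [intervalIntegral.integral_sub hφi hχi, intervalIntegral.integral_const_mul,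
    intervalIntegral.integral_sub intervalIntegrable_const (hψi.const_mul D),
    intervalIntegral.integral_const_mul, intervalIntegral.integral_mul_const,
    integral_exp_neg_mul hρ, intervalIntegral.integral_const, smul_eq_mul, sub_zero] at hint
  have h1 : (1 - Real.exp (-ρ * T)) / ρ * S = value ρ u F W x - e * value ρ u F W x := by
    rw [← he, hS]
    field_simp
  have h2 := mul_le_mul_of_nonneg_left htail he0.le
  have h3 : e * (D * ∫ t in (0 : ℝ)..T, ((B - F (k t) (c t)) / m + 1 - C)) ≤ 0 :=
    mul_nonpos_of_nonneg_of_nonpos he0.le (mul_nonpos_of_nonneg_of_nonpos hD0.le hψ)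
  rw [h1] at hint
  linarith

end

/-- The Hamiltonian, with the supremum taken over positive consumption. -/
noncomputable def hamiltonian (u : ℝ → ℝ → EReal) (F : ℝ → ℝ → ℝ) (k p : ℝ) : ℝ :=
  sSup ((fun c => F k c * p + (u c k).toReal) '' Ioi 0)

/-! ### The Hamiltonian and the inequality H ≥ ρV -/

section

variable {ρ : ℝ} {u : ℝ → ℝ → EReal} {F : ℝ → ℝ → ℝ} {W : Set (ℝ → ℝ)}

theorem hamiltonian_le_of_forall {k p b : ℝ}
    (h : ∀ c, 0 < c → F k c * p + (u c k).toReal ≤ b) : hamiltonian u F k p ≤ b := by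
  refine csSup_le ⟨_, mem_image_of_mem _ (mem_Ioi.2 one_pos)⟩ ?_
  rintro _ ⟨c, hc, rfl⟩
  exact h c hc

theorem Standing.le_hamiltonian (h : Standing ρ u F W) {k p c : ℝ} (hk : 0 < k) (hp : 0 < p)
    (hc : 0 < c) : F k c * p + (u c k).toReal ≤ hamiltonian u F k p := by
  refine le_csSup ?_ (mem_image_of_mem _ hc)
  obtain ⟨A, m, hm, hb⟩ := h.a3.exists_linear_bound k
  -- Beyond c₁ the marginal utility is below p·m, the least marginal cost of consumption, so the
  -- tangent at c₁ bounds the objective.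
  obtain ⟨c₁, hc₁, hc₁0⟩ := (((h.a4.tendsto_infty k hk).eventually_lt_const
    (mul_pos hp hm)).and (eventually_gt_atTop 0)).exists
  refine ⟨p * A + (u c₁ k).toReal, ?_⟩
  rintro _ ⟨c, hc, rfl⟩
  have hc : 0 < c := hc
  have h1 := mul_le_mul_of_nonneg_right (hb k c hk.le le_rfl hc.le) hp.le
  have h2 := h.a2.le_tangent hc hc₁0 hk
  have h3 := mul_le_mul_of_nonneg_right hc₁.le hc.le
  have h4 := mul_pos (du_dc_pos h.a2 hc₁0 hk) hc₁0
  simp only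
  linarith

theorem exists_lt_of_lt_hamiltonian {k p r : ℝ} (hr : r < hamiltonian u F k p) :
    ∃ c, 0 < c ∧ r < F k c * p + (u c k).toReal := by
  obtain ⟨_, ⟨c, hc, rfl⟩, h⟩ :=
    exists_lt_of_lt_csSup ⟨_, mem_image_of_mem _ (mem_Ioi.2 one_pos)⟩ hr
  exact ⟨c, hc, h⟩

theorem Standing.convexOn_hamiltonian (h : Standing ρ u F W) {k : ℝ} (hk : 0 < k) :
    ConvexOn ℝ (Ioi 0) (hamiltonian u F k) := by
  refine ⟨convex_Ioi 0, fun p hp q hq a b ha hb hab => hamiltonian_le_of_forall fun c hc => ?_⟩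
  have h1 := mul_le_mul_of_nonneg_left (h.le_hamiltonian hk hp hc) ha
  have h2 := mul_le_mul_of_nonneg_left (h.le_hamiltonian hk hq hc) hb
  obtain rfl : a = 1 - b := by linarith
  simp only [smul_eq_mul]
  linarith

/-- A partial supremum over c of a function jointly concave in (k, c); p > 0 preserves the concavity
of F. -/
theorem Standing.concaveOn_hamiltonian (h : Standing ρ u F W) {p : ℝ} (hp : 0 < p) :
    ConcaveOn ℝ (Ioi 0) (fun k => hamiltonian u F k p) := by
  refine concaveOn_iff_forall_pos.2 ⟨convex_Ioi 0, fun k hk l hl a b ha hb hab => ?_⟩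
  have hk : 0 < k := hk
  have hl : 0 < l := hl
  refine le_of_forall_pos_le_add fun ε hε => ?_
  obtain ⟨c, hc, h1⟩ := exists_lt_of_lt_hamiltonian (sub_lt_self (hamiltonian u F k p) hε)
  obtain ⟨d, hd, h2⟩ := exists_lt_of_lt_hamiltonian (sub_lt_self (hamiltonian u F l p) hε)
  have h3 := h.a3.concave.2 (show (k, c) ∈ Ici (0 : ℝ) ×ˢ Ici (0 : ℝ) from ⟨hk.le, hc.le⟩)
    (show (l, d) ∈ Ici (0 : ℝ) ×ˢ Ici (0 : ℝ) from ⟨hl.le, hd.le⟩) ha.le hb.le hab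
  have h4 := h.a2.concaveOn.2 (show (c, k) ∈ Ioi (0 : ℝ) ×ˢ Ioi (0 : ℝ) from ⟨hc, hk⟩)
    (show (d, l) ∈ Ioi (0 : ℝ) ×ˢ Ioi (0 : ℝ) from ⟨hd, hl⟩) ha.le hb.le hab
  have h5 := h.le_hamiltonian (show 0 < a * k + b * l by positivity) hp
    (show 0 < a * c + b * d by positivity)
  simp only [Prod.smul_mk, Prod.mk_add_mk, smul_eq_mul] at h3 h4 ⊢
  have h3 := mul_le_mul_of_nonneg_right h3 hp.le
  have h1 := mul_le_mul_of_nonneg_left h1.le ha.le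
  have h2 := mul_le_mul_of_nonneg_left h2.le hb.le
  have h6 : a * ε + b * ε = ε := by rw [← add_mul, hab, one_mul]
  linarith

/-- Integration by parts along a plan. -/
theorem IsPlan.integral_exp_mul {x T : ℝ} {k c : ℝ → ℝ} (hp : IsPlan ρ u F W x k c)
    (hT : 0 ≤ T) : ∫ t in (0 : ℝ)..T, Real.exp (-ρ * t) * F (k t) (c t) =
      Real.exp (-ρ * T) * (k T - x) + ρ * ∫ t in (0 : ℝ)..T, Real.exp (-ρ * t) * (k t - x) := by
  have hFi := hp.intervalIntegrable T hT
  have hexp : AbsolutelyContinuousOnInterval (fun t : ℝ => Real.exp (-ρ * t)) 0 T := by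
    refine ContDiffOn.absolutelyContinuousOnInterval ?_
    exact ContDiff.contDiffOn (by fun_prop)
  have hy := hFi.absolutelyContinuousOnInterval_intervalIntegral (c := 0) left_mem_uIcc
  have key := hexp.integral_mul_deriv_eq_deriv_mul hy
  have e1 : ∫ t in (0 : ℝ)..T, Real.exp (-ρ * t) *
      deriv (fun t => ∫ s in (0 : ℝ)..t, F (k s) (c s)) t =
      ∫ t in (0 : ℝ)..T, Real.exp (-ρ * t) * F (k t) (c t) := by
    refine intervalIntegral.integral_congr_ae ?_
    filter_upwards [hFi.ae_hasDerivAt_integral] with t ht ht'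
    rw [(ht (uIoc_subset_uIcc ht') 0 left_mem_uIcc).deriv]
  have e2 : ∫ t in (0 : ℝ)..T, deriv (fun t : ℝ => Real.exp (-ρ * t)) t *
      (∫ s in (0 : ℝ)..t, F (k s) (c s)) =
      -ρ * ∫ t in (0 : ℝ)..T, Real.exp (-ρ * t) * (k t - x) := by
    rw [← intervalIntegral.integral_const_mul]
    refine intervalIntegral_congr_uIoc fun t ht => ?_
    rw [uIoc_of_le hT] at ht
    have hd : HasDerivAt (fun t : ℝ => Real.exp (-ρ * t)) (Real.exp (-ρ * t) * -ρ) t := by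
      have h1 : HasDerivAt (fun t : ℝ => -ρ * t) (-ρ) t := by
        simpa using (hasDerivAt_id t).const_mul (-ρ)
      exact h1.exp
    rw [hd.deriv, hp.eq_integral t ht.1.le]
    ring
  rw [e1, e2] at key
  rw [key, hp.eq_integral T hT]
  simp

/-- Every supergradient of the value function is almost a subsolution of the HJB equation. -/
theorem Standing.exists_le_hamiltonian_add (h : Standing ρ u F W) {x p : ℝ} (hx : 0 < x)
    (hp : IsSupergradient (value ρ u F W) x p) :
    ∃ C : ℝ, ∀ q, 0 < q → q < p →
      ρ * value ρ u F W x ≤ hamiltonian u F x q + (p - q) * C := by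
  have hρ := h.a1.rho_pos
  obtain ⟨A, hA, hF⟩ := h.a3.exists_growth_bound
  -- A bound for the speed of capital: k ≤ 2x + 1 as long as AT ≤ 1/2.
  set C := A * (2 + 2 * x) with hC
  have hC0 : 0 < C := by positivity
  refine ⟨C, fun q hq hqp => ?_⟩
  set H := hamiltonian u F x q with hH
  obtain ⟨g, hg⟩ := exists_isSupergradient (h.concaveOn_hamiltonian hq) hx
  have hbound : ∀ c k, 0 ≤ c → 0 ≤ k → u c k ≤ ((H + g * (k - x) - q * F k c : ℝ) : EReal) := by
    intro c k hc hk
    refine h.a2.le_of_le_interior (φ := fun y => H + g * (y.2 - x) - q * F y.2 y.1) ?_ ?_ hc hk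
    · have : ContinuousOn (fun y : ℝ × ℝ => F y.2 y.1) (Ici 0 ×ˢ Ici 0) :=
        h.a3.continuousOn.comp (f := fun y : ℝ × ℝ => (y.2, y.1)) (by fun_prop)
          fun y hy => ⟨hy.2, hy.1⟩
      exact ContinuousOn.sub (by fun_prop) (continuousOn_const.mul this)
    · intro c k hc hk
      have h1 := h.le_hamiltonian hk hq hc
      have h2 := hg k hk
      simp only at h2 ⊢
      linarith
  set M := |g - q * ρ| with hM
  have hM0 : 0 ≤ M := abs_nonneg _
  have hpq : 0 < p - q := sub_pos.2 hqp
  have hsmall1 : ∀ᶠ T in 𝓝[>] (0 : ℝ), A * T < 1 / 2 := by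
    have : Continuous (fun T : ℝ => A * T) := by fun_prop
    exact ((this.tendsto 0).mono_left nhdsWithin_le_nhds).eventually_lt_const (by norm_num)
  -- This is where q < p is used: the cost of ending below x outweighs the error M·T per unit of the
  -- drop.
  have hsmall2 : ∀ᶠ T in 𝓝[>] (0 : ℝ), M * T - (p - q) * Real.exp (-ρ * T) < 0 := by
    have : Continuous (fun T : ℝ => M * T - (p - q) * Real.exp (-ρ * T)) := by fun_prop
    exact ((this.tendsto 0).mono_left nhdsWithin_le_nhds).eventually_lt_const (by simpa)
  have hlim := tendsto_discount_div hρ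
  have hlimT : Tendsto (fun T : ℝ => T) (𝓝[>] 0) (𝓝 0) := nhdsWithin_le_nhds
  have hL := hlim.const_mul (ρ * value ρ u F W x)
  have hR := ((hlim.const_mul H).add (hlimT.const_mul (M * C))).add
    (tendsto_const_nhds (x := (p - q) * C))
  rw [mul_one] at hL
  rw [mul_one, mul_zero, add_zero] at hR
  refine le_of_tendsto_of_tendsto hL hR ?_
  filter_upwards [hsmall1, hsmall2, self_mem_nhdsWithin] with T hAT hMT hT
  have hT : 0 < T := hT
  set e := Real.exp (-ρ * T) with he
  have he0 : 0 < e := Real.exp_pos _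
  have he1 : e ≤ 1 := Real.exp_le_one_iff.2 (by nlinarith)
  set E := (1 - e) / ρ with hE
  have hmain : value ρ u F W x ≤
      H * E + e * value ρ u F W x + M * C * T * T + (p - q) * C * T := by
    refine le_of_forall_pos_le_add fun ε hε => ?_
    obtain ⟨k, c, hk, hval⟩ := h.exists_plan hx (sub_lt_self (value ρ u F W x) hε)
    rw [hk.payoff_eq hT.le] at hval
    have htail := mul_le_mul_of_nonneg_left
      (h.payoff_le hp (hk.k_nonneg T hT.le) (hk.tail hT.le)) he0.le
    have hkK := hk.le_of_growth hA hF hT.le hAT.le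
    have hFC : ∀ t ∈ Icc 0 T, F (k t) (c t) ≤ C := fun t ht => by
      refine (hF _ _ (hk.k_nonneg t ht.1) (hk.c_nonneg t ht.1)).trans ?_
      rw [hC]
      refine mul_le_mul_of_nonneg_left ?_ hA.le
      linarith [hkK t ht]
    have hFi := hk.intervalIntegrable T hT.le
    have hup : ∀ s t, 0 ≤ s → s ≤ t → t ≤ T → k t - k s ≤ C * (t - s) := fun s t hs hst htT => by
      have h1 := hk.intervalIntegrable s hs
      have h2 := hk.intervalIntegrable t (hs.trans hst)
      rw [hk.eq_integral t (hs.trans hst), hk.eq_integral s hs, add_sub_add_left_eq_sub,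
        intervalIntegral.integral_interval_sub_left h2 h1]
      have := intervalIntegral.integral_mono_on hst (h1.symm.trans h2)
        (intervalIntegrable_const (c := C)) fun r hr => hFC r ⟨hs.trans hr.1, hr.2.trans htT⟩
      rw [intervalIntegral.integral_const, smul_eq_mul] at this
      linarith
    -- Upward speed is at most C, so a dip during [0, T] cannot be deeper than the final shortfall
    -- plus CT.
    set b := C * T + max (x - k T) 0 with hb
    have hyb : ∀ t ∈ Icc 0 T, |k t - x| ≤ b := fun t ht => by
      have h1 := hup 0 t le_rfl ht.1 ht.2
      have h2 := hup t T ht.1 ht.2 le_rfl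
      rw [hk.initial, sub_zero] at h1
      have h3 : C * t ≤ C * T := mul_le_mul_of_nonneg_left ht.2 hC0.le
      have h4 : C * (T - t) ≤ C * T := mul_le_mul_of_nonneg_left (by linarith [ht.1]) hC0.le
      rw [abs_le]
      constructor
      · linarith [le_max_left (x - k T) 0]
      · linarith [le_max_right (x - k T) 0]
    have hyc : ContinuousOn (fun t => Real.exp (-ρ * t) * (k t - x)) (uIcc 0 T) := by
      rw [uIcc_of_le hT.le]
      exact ContinuousOn.mul (by fun_prop)
        ((hk.continuousOn.mono fun t ht => ht.1).sub continuousOn_const)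
    have hyi := hyc.intervalIntegrable (μ := volume)
    have hei : IntervalIntegrable (fun t => Real.exp (-ρ * t) * F (k t) (c t)) volume 0 T :=
      hFi.continuousOn_mul (by fun_prop)
    have hhi : IntervalIntegrable (fun t => Real.exp (-ρ * t) * H) volume 0 T :=
      Continuous.intervalIntegrable (by fun_prop) 0 T
    set I := ∫ t in (0 : ℝ)..T, Real.exp (-ρ * t) * (k t - x) with hI
    have hIb : |I| ≤ b * T := by
      have := intervalIntegral.norm_integral_le_of_norm_le_const (a := (0 : ℝ)) (b := T) (C := b)
        (f := fun t => Real.exp (-ρ * t) * (k t - x)) fun t ht => by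
          rw [uIoc_of_le hT.le] at ht
          rw [norm_mul, Real.norm_eq_abs, Real.norm_eq_abs, abs_of_pos (Real.exp_pos _)]
          have h1 : Real.exp (-ρ * t) ≤ 1 := Real.exp_le_one_iff.2 (by nlinarith [ht.1])
          have h2 := hyb t ⟨ht.1.le, ht.2⟩
          calc _ ≤ 1 * |k t - x| := by gcongr
            _ ≤ b := by rwa [one_mul]
      rwa [sub_zero, abs_of_pos hT, Real.norm_eq_abs] at this
    have hint := hk.integral_discounted_le hT.le
      ((hhi.add (hyi.const_mul g)).sub (hei.const_mul q)) fun t ht0 htT hbot => by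
        have h1 := hbound (c t) (k t) (hk.c_nonneg t ht0) (hk.k_nonneg t ht0)
        rw [← EReal.coe_toReal (h.a2.ne_top _ _ (hk.c_nonneg t ht0) (hk.k_nonneg t ht0)) hbot] at h1
        have h2 := mul_le_mul_of_nonneg_left (EReal.coe_le_coe_iff.1 h1) (Real.exp_pos (-ρ * t)).le
        simp only [discounted]
        linarith
    rw [intervalIntegral.integral_sub (hhi.add (hyi.const_mul g)) (hei.const_mul q),
      intervalIntegral.integral_add hhi (hyi.const_mul g), intervalIntegral.integral_const_mul,
      intervalIntegral.integral_const_mul, intervalIntegral.integral_mul_const,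
      integral_exp_neg_mul hρ, hk.integral_exp_mul hT.le, ← hI, ← he, ← hE] at hint
    have hMI : (g - q * ρ) * I ≤ M * (b * T) := by
      refine (le_abs_self _).trans ?_
      rw [abs_mul]
      gcongr
    -- If k(T) ≥ x, the displacement is at most CT; otherwise the negative term in p − q absorbs the
    -- shortfall contained in b.
    have hlast : M * (b * T) + e * ((p - q) * (k T - x)) ≤
        M * C * T * T + (p - q) * C * T := by
      have hCT : k T - x ≤ C * T := by
        have := hup 0 T le_rfl hT.le le_rfl
        rwa [hk.initial, sub_zero] at this
      rcases le_total x (k T) with hle | hle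
      · have h1 : b = C * T := by rw [hb, max_eq_right (by linarith), add_zero]
        have h2 : e * ((p - q) * (k T - x)) ≤ 1 * ((p - q) * (C * T)) := by
          have : 0 ≤ k T - x := by linarith
          gcongr
        rw [h1]
        linarith
      · have h1 : b = C * T + (x - k T) := by rw [hb, max_eq_left (by linarith)]
        have h2 : (M * T - (p - q) * e) * (x - k T) ≤ 0 :=
          mul_nonpos_of_nonpos_of_nonneg hMT.le (by linarith)
        have h3 : 0 ≤ (p - q) * C * T := by positivity
        rw [h1]
        linarith
    linarith
  have hVE : ρ * value ρ u F W x * E = value ρ u F W x - e * value ρ u F W x := by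
    rw [hE]
    field_simp
  calc ρ * value ρ u F W x * (E / T) = (ρ * value ρ u F W x * E) / T := by ring
    _ ≤ (H * E + M * C * T * T + (p - q) * C * T) / T := by
      gcongr
      linarith
    _ = _ := by field_simp

/-- Every supergradient of the value function solves the HJB equation. -/
theorem Standing.hamiltonian_eq (h : Standing ρ u F W) {x p : ℝ} (hx : 0 < x)
    (hp : IsSupergradient (value ρ u F W) x p) :
    hamiltonian u F x p = ρ * value ρ u F W x := by
  refine le_antisymm (hamiltonian_le_of_forall fun c hc => h.hamiltonian_le hx hc hp) ?_
  have hp0 := h.supergradient_pos hx hp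
  obtain ⟨C, hC⟩ := h.exists_le_hamiltonian_add hx hp
  have hcont : ContinuousAt (hamiltonian u F x) p :=
    ((h.convexOn_hamiltonian hx).continuousOn isOpen_Ioi).continuousAt (Ioi_mem_nhds hp0)
  have hlim : Tendsto (fun q => hamiltonian u F x q + (p - q) * C) (𝓝[<] p)
      (𝓝 (hamiltonian u F x p)) := by
    have : ContinuousAt (fun q => hamiltonian u F x q + (p - q) * C) p :=
      hcont.add (by fun_prop)
    simpa using this.tendsto.mono_left nhdsWithin_le_nhds
  refine ge_of_tendsto hlim ?_
  filter_upwards [Ioo_mem_nhdsLT hp0] with q hq using hC q hq.1 hq.2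

end

/-! ### Uniqueness of the supergradient and the HJB equation -/

section

variable {ρ : ℝ} {u : ℝ → ℝ → EReal} {F : ℝ → ℝ → ℝ} {W : Set (ℝ → ℝ)}

/-- If the Hamiltonian is constant between two prices, then a consumption which keeps capital
constant is optimal for both. -/
theorem Standing.exists_stationary (h : Standing ρ u F W) {x p q a : ℝ} (hx : 0 < x) (hpq : p < q)
    (hle : ∀ r ∈ Icc p q, ∀ c, 0 < c → F x c * r + (u c x).toReal ≤ a)
    (hlt : ∀ r ∈ Icc p q, ∀ b, b < a → ∃ c, 0 < c ∧ b < F x c * r + (u c x).toReal) :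
    ∃ c, 0 ≤ c ∧ F x c = 0 ∧ u c x = (a : EReal) := by
  set r := (p + q) / 2 with hr
  set d := (q - p) / 2 with hd
  have hd0 : 0 < d := by rw [hd]; linarith
  have hpm : p ∈ Icc p q := left_mem_Icc.2 hpq.le
  have hqm : q ∈ Icc p q := right_mem_Icc.2 hpq.le
  have hrm : r ∈ Icc p q := by rw [hr]; constructor <;> linarith
  obtain ⟨s, -, hs0, hs⟩ := exists_seq_strictAnti_tendsto (0 : ℝ)
  have hex : ∀ n, ∃ c, 0 < c ∧ a - s n < F x c * r + (u c x).toReal := fun n =>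
    hlt r hrm _ (sub_lt_self a (hs0 n))
  choose c hc0 hc using hex
  -- The objective is affine in the price with slope F, is at most a at p and q, and exceeds a − s n
  -- at the midpoint.
  have hFs : ∀ n, |F x (c n)| ≤ s n / d := fun n => by
    have h1 := hle p hpm _ (hc0 n)
    have h2 := hle q hqm _ (hc0 n)
    have h3 := hc n
    rw [le_div_iff₀ hd0, ← abs_of_pos hd0, ← abs_mul, abs_le]
    have e1 : F x (c n) * d = F x (c n) * q - F x (c n) * r := by rw [hd, hr]; ring
    have e2 : F x (c n) * d = F x (c n) * r - F x (c n) * p := by rw [hd, hr]; ring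
    constructor <;> linarith
  have hF0 : Tendsto (fun n => F x (c n)) atTop (𝓝 0) := by
    have := hs.div_const d
    rw [zero_div] at this
    exact squeeze_zero_norm hFs this
  have hU : Tendsto (fun n => (u (c n) x).toReal) atTop (𝓝 a) := by
    have l1 : Tendsto (fun n => a - s n - F x (c n) * r) atTop (𝓝 a) := by
      simpa using (tendsto_const_nhds.sub hs).sub (hF0.mul_const r)
    have l2 : Tendsto (fun n => a - F x (c n) * r) atTop (𝓝 a) := by
      simpa using tendsto_const_nhds.sub (hF0.mul_const r)
    refine tendsto_of_tendsto_of_tendsto_of_le_of_le l1 l2 (fun n => ?_) fun n => ?_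
    · have := hc n
      simp only
      linarith
    · have := hle r hrm _ (hc0 n)
      simp only
      linarith
  obtain ⟨A, m, hm, hb⟩ := h.a3.exists_linear_bound x
  obtain ⟨B, hB⟩ := hF0.bddBelow_range
  -- Speeds bounded below keep consumption in a compact set. The limit may be 0, so utility is
  -- passed to the limit in `EReal`.
  have hmem : ∀ n, c n ∈ Icc 0 ((A - B) / m) := fun n => by
    have h1 := hb x (c n) hx.le le_rfl (hc0 n).le
    have h2 : B ≤ F x (c n) := hB (mem_range_self n)
    refine ⟨(hc0 n).le, ?_⟩
    rw [le_div_iff₀ hm]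
    linarith
  obtain ⟨c', hc', φ, hφ, hlim⟩ := isCompact_Icc.tendsto_subseq hmem
  have hlim' : Tendsto (c ∘ φ) atTop (𝓝[Ici 0] c') :=
    tendsto_nhdsWithin_iff.2 ⟨hlim, Eventually.of_forall fun n => (hc0 _).le⟩
  refine ⟨c', hc'.1, ?_, ?_⟩
  · exact tendsto_nhds_unique ((h.a3.continuousOn_right hx.le c' hc'.1).tendsto.comp hlim')
      (hF0.comp hφ.tendsto_atTop)
  · have hu : ContinuousOn (fun c => u c x) (Ici 0) :=
      h.a2.continuousOn.comp (f := fun c : ℝ => (c, x)) (by fun_prop) fun c hc => ⟨hc, hx.le⟩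
    refine tendsto_nhds_unique ((hu c' hc'.1).tendsto.comp hlim') ?_
    have := (continuous_coe_real_ereal.tendsto a).comp (hU.comp hφ.tendsto_atTop)
    refine this.congr fun n => ?_
    simp only [Function.comp]
    exact h.a2.coe_toReal (hc0 _) hx

/-- A consumption which keeps capital constant is optimal for at most one price. -/
theorem Standing.price_unique (h : Standing ρ u F W) {x p q a c : ℝ} (hx : 0 < x)
    (hp : ∀ c, 0 < c → F x c * p + (u c x).toReal ≤ a)
    (hq : ∀ c, 0 < c → F x c * q + (u c x).toReal ≤ a)
    (hc : 0 ≤ c) (hFc : F x c = 0) (huc : u c x = (a : EReal))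
    (hd : DifferentiableWithinAt ℝ (fun y => F x y) (Ici 0) c) : p = q := by
  rcases hc.lt_or_eq with hc0 | rfl
  · have hd' := (hd.differentiableAt (Ici_mem_nhds hc0)).hasDerivAt
    have hu := h.a2.hasDerivAt hc0 hx
    have hcrit : ∀ r, (∀ c, 0 < c → F x c * r + (u c x).toReal ≤ a) →
        deriv (fun y => F x y) c * r + du_dc u c x = 0 := fun r hr => by
      refine IsLocalMax.hasDerivAt_eq_zero (f := fun y => F x y * r + (u y x).toReal) ?_
        ((hd'.mul_const r).add hu)
      filter_upwards [eventually_gt_nhds hc0] with y hy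
      have := hr y hy
      rwa [hFc, huc, zero_mul, zero_add, EReal.toReal_coe]
    have h1 := hcrit p hp
    have h2 := hcrit q hq
    have h3 := du_dc_pos h.a2 hc0 hx
    have h4 : deriv (fun y => F x y) c ≠ 0 := by
      intro h0
      rw [h0, zero_mul] at h1
      linarith
    exact mul_left_cancel₀ h4 (by linarith)
  -- At c = 0, optimality and the tangent at small c give u_c(c, x)·c ≤ −F(x, c)q. After division by
  -- c the right side stays bounded, since F has a right derivative at 0, while u_c tends to +∞.
  · exfalso
    have hslope := hd.hasDerivWithinAt.mono (Ioi_subset_Ici_self)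
    rw [hasDerivWithinAt_iff_tendsto_slope' (by simp)] at hslope
    set D := derivWithin (fun y => F x y) (Ici 0) 0
    have hlim : Tendsto (fun c => -slope (fun y => F x y) 0 c * q) (𝓝[>] 0) (𝓝 (-D * q)) :=
      hslope.neg.mul_const q
    have hU0 : Tendsto (fun c => (u c x).toReal) (𝓝[>] 0) (𝓝 a) := by
      have hu : ContinuousOn (fun c => u c x) (Ici 0) :=
        h.a2.continuousOn.comp (f := fun c : ℝ => (c, x)) (by fun_prop) fun c hc => ⟨hc, hx.le⟩
      have h1 := (hu 0 (mem_Ici.2 le_rfl)).tendsto.mono_left (nhdsWithin_mono 0 Ioi_subset_Ici_self)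
      rw [huc] at h1
      exact (EReal.tendsto_toReal (EReal.coe_ne_top a) (EReal.coe_ne_bot a)).comp h1
    obtain ⟨c, h1, h2, hc⟩ := (((h.a4.tendsto_zero x hx).eventually_gt_atTop (-D * q + 1)).and
      ((hlim.eventually_lt_const (lt_add_one _)).and eventually_mem_nhdsWithin)).exists
    have hc : 0 < c := hc
    have hle : a ≤ (u c x).toReal - du_dc u c x * c := by
      have hr : Tendsto (fun y => (u c x).toReal + du_dc u c x * (y - c)) (𝓝[>] 0)
          (𝓝 ((u c x).toReal + du_dc u c x * (0 - c))) := by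
        have : Continuous (fun y => (u c x).toReal + du_dc u c x * (y - c)) := by fun_prop
        exact (this.tendsto 0).mono_left nhdsWithin_le_nhds
      have := le_of_tendsto_of_tendsto hU0 hr (by
        filter_upwards [self_mem_nhdsWithin] with y hy using h.a2.le_tangent hy hc hx)
      linarith
    have h3 := hq c hc
    rw [slope_def_field, hFc, sub_zero, sub_zero, neg_mul, div_mul_eq_mul_div, ← neg_div] at h2
    have h4 : -(F x c * q) / c < du_dc u c x := h2.trans h1
    rw [div_lt_iff₀ hc] at h4
    linarith

theorem Standing.supergradient_unique (h : Standing ρ u F W)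
    (hdiff : ∀ k c : ℝ, 0 ≤ k → 0 ≤ c → F k c = 0 →
      DifferentiableWithinAt ℝ (fun x => F k x) (Ici 0) c) {x p q : ℝ} (hx : 0 < x)
    (hp : IsSupergradient (value ρ u F W) x p) (hq : IsSupergradient (value ρ u F W) x q) :
    p = q := by
  wlog hpq : p < q generalizing p q
  · rcases (not_lt.1 hpq).lt_or_eq with hlt | heq
    · exact (this hq hp hlt).symm
    · exact heq.symm
  have hsup : ∀ r ∈ Icc p q, IsSupergradient (value ρ u F W) x r := fun r hr y hy => by
    have h1 := hp y hy
    have h2 := hq y hy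
    rcases le_total x y with hxy | hxy
    · have := mul_le_mul_of_nonneg_right hr.1 (sub_nonneg.2 hxy)
      linarith
    · have := mul_le_mul_of_nonneg_right hr.2 (sub_nonneg.2 hxy)
      linarith
  have hle : ∀ r ∈ Icc p q, ∀ c, 0 < c →
      F x c * r + (u c x).toReal ≤ ρ * value ρ u F W x := fun r hr c hc =>
    h.hamiltonian_le hx hc (hsup r hr)
  obtain ⟨c, hc, hFc, huc⟩ := h.exists_stationary hx hpq hle fun r hr b hb =>
    exists_lt_of_lt_hamiltonian (by rwa [h.hamiltonian_eq hx (hsup r hr)])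
  exact h.price_unique hx (hle p (left_mem_Icc.2 hpq.le)) (hle q (right_mem_Icc.2 hpq.le)) hc hFc huc
    (hdiff x c hx.le hc hFc)

/-- Allowing c = 0 does not raise the supremum: u(0, x) ≤ u(c, x) ≤ ρV(x) − F(x, c)p for c > 0, and
c tends to 0. -/
theorem Standing.iSup_hamiltonian_eq (h : Standing ρ u F W) {x p : ℝ} (hx : 0 < x)
    (hp : IsSupergradient (value ρ u F W) x p) :
    ⨆ c ∈ Ici (0 : ℝ), (((F x c * p : ℝ) : EReal) + u c x) = ((ρ * value ρ u F W x : ℝ) : EReal) := by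
  have hpos : ∀ c, 0 < c → ((F x c * p : ℝ) : EReal) + u c x =
      ((F x c * p + (u c x).toReal : ℝ) : EReal) := fun c hc => by
    rw [EReal.coe_add, h.a2.coe_toReal hc hx]
  refine le_antisymm (iSup₂_le fun c hc => ?_) (le_of_forall_lt fun b hb => ?_)
  · rcases (mem_Ici.1 hc).lt_or_eq with hc0 | rfl
    · rw [hpos c hc0]
      exact_mod_cast h.hamiltonian_le hx hc0 hp
    · have hlim : Tendsto (fun c => F x c * p) (𝓝[>] 0) (𝓝 (F x 0 * p)) :=
        ((h.a3.continuousOn_right hx.le 0 hc).tendsto.mono_left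
          (nhdsWithin_mono 0 Ioi_subset_Ici_self)).mul_const p
      have hub : u 0 x ≤ ((ρ * value ρ u F W x - F x 0 * p : ℝ) : EReal) := by
        refine ge_of_tendsto ((continuous_coe_real_ereal.tendsto _).comp
          (tendsto_const_nhds.sub hlim)) ?_
        filter_upwards [self_mem_nhdsWithin] with c hc
        have hc : 0 < c := hc
        refine (h.a2.nondecreasing 0 x c x le_rfl hx.le hc.le le_rfl).trans ?_
        rw [← h.a2.coe_toReal hc hx]
        have := h.hamiltonian_le hx hc hp
        exact EReal.coe_le_coe_iff.2 (by linarith)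
      calc ((F x 0 * p : ℝ) : EReal) + u 0 x
          ≤ ((F x 0 * p : ℝ) : EReal) + ((ρ * value ρ u F W x - F x 0 * p : ℝ) : EReal) := by gcongr
        _ = _ := by rw [← EReal.coe_add]; congr 1; ring
  · obtain ⟨r, hbr, hr⟩ := EReal.lt_iff_exists_real_btwn.1 hb
    have hr : r < hamiltonian u F x p := by
      rw [h.hamiltonian_eq hx hp]
      exact_mod_cast hr
    obtain ⟨c, hc, hlt⟩ := exists_lt_of_lt_hamiltonian hr
    refine (hbr.trans (EReal.coe_lt_coe_iff.2 hlt)).trans_le ?_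
    rw [← hpos c hc]
    exact le_iSup₂ (f := fun c (_ : c ∈ Ici (0 : ℝ)) => ((F x c * p : ℝ) : EReal) + u c x) c
      (mem_Ici.2 hc.le)

end

end GrowthModel

theorem proposition6 (ρ : ℝ) (u : ℝ → ℝ → EReal) (F : ℝ → ℝ → ℝ) (W : Set (ℝ → ℝ))
    (h1 : GrowthModel.Assumption1 ρ W) (h2 : GrowthModel.Assumption2 u)
    (h3 : GrowthModel.Assumption3 F W) (h4 : GrowthModel.Assumption4 u)
    (hfin : GrowthModel.IsFinite (GrowthModel.valueFunction ρ u F W))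
    (hdiff : ∀ k c : ℝ, 0 ≤ k → 0 ≤ c → F k c = 0 →
      DifferentiableWithinAt ℝ (fun x => F k x) (Ici 0) c) :
    GrowthModel.IsContDiff (GrowthModel.valueFunction ρ u F W) ∧
      GrowthModel.IsClassicalSolution ρ u F (GrowthModel.valueFunction ρ u F W) := by
  have h : GrowthModel.Standing ρ u F W := ⟨h1, h2, h3, h4, hfin⟩
  have hC : GrowthModel.IsContDiff (GrowthModel.valueFunction ρ u F W) :=
    ⟨hfin, GrowthModel.contDiffOn_of_unique_supergradient h.concaveOn_value
      fun x hx p q hp hq => h.supergradient_unique hdiff hx hp hq⟩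
  refine ⟨hC, hC, fun k hk => ?_⟩
  have hd : HasDerivAt (GrowthModel.value ρ u F W) (deriv (GrowthModel.value ρ u F W) k) k :=
    ((hC.2.contDiffAt (Ioi_mem_nhds hk)).differentiableAt (by simp)).hasDerivAt
  have key := h.iSup_hamiltonian_eq hk
    (GrowthModel.isSupergradient_of_hasDerivAt h.concaveOn_value hk hd)
  rw [← h.coe_value hk, ← EReal.coe_mul]
  -- The derivative in the goal is that of `value`, unfolded, so `key` matches up to definitional
  -- equality.
  refine (congrArg (· - ((ρ * GrowthModel.value ρ u F W k : ℝ) : EReal)) key).trans ?_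
  rw [← EReal.coe_sub, sub_self, EReal.coe_zero]
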